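/- Let $\Omega$ be a compact metric space with a continuous flow $\sigma\colon\mathbb{R}\times\Omega\to\Omega$, $(t,\omega)\mapsto\omega\cdot t$, and let $f\colon\Omega\times\mathbb{R}\to\mathbb{R}$ be jointly continuous, with $f_x$ existing and jointly continuous. Let $t\mapsto u(t,\omega,x_0)$ be the maximal solution of $x'=f(\omega\cdot t,x)$, $x(0)=x_0$, and let $\tau(t,\omega,x_0)=(\omega\cdot t,u(t,\omega,x_0))$ be the induced local flow on $\Omega\times\mathbb{R}$. Let $m$ be a $\sigma$-ergodic Borel probability measure on $\Omega$, and let $\mathcal{K}\subset\Omega\times\mathbb{R}$ be a compact $\tau$-invariant set (that is, a compact union of globally defined $\tau$-orbits) which projects onto $\Omega$. Put $J=[\inf_{(\omega,x)\in\mathcal{K}}x,\ \sup_{(\omega,x)\in\mathcal{K}}x]$, let $l(J)$ be its length, and for $0<\epsilon\le l(J)/2$ put $$b_{J,\epsilon}(\omega)=\frac{\epsilon}{4\,l(J)^2}\min\bigl\{2f_x(\omega,x)-f_x(\omega,x-\epsilon/2)-f_x(\omega,x+\epsilon/2)\colon\ [x-\epsilon/2,x+\epsilon/2]\subseteq J\bigr\}.$$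 Assume that $f$ is strictly d-concave with respect to $m$ on $J$: $f_x(\omega,\cdot)$ is concave on $\mathbb{R}$ for every $\omega\in\Omega$, and there is $\rho>0$ such that $m(\{\omega\in\Omega\colon b_{J,\epsilon}(\omega)>0\})>\rho$ for all $\epsilon\in(0,l(J)/2]$. Then there exist at most three distinct $\tau$-ergodic Borel probability measures concentrated on $\mathcal{K}$ which project onto $m$. Moreover, if there are exactly three such measures, they can be labelled $\nu_1,\nu_2,\nu_3$ in such a way that there are $m$-measurable maps $\beta_1,\beta_2,\beta_3\colon\Omega\to\mathbb{R}$ with graphs contained in $\mathcal{K}$, which are $\tau$-equilibria ($\beta_i(\omega\cdot t)=u(t,\omega,\beta_i(\omega))$ for all $\omega\in\Omega$, $t\in\mathbb{R}$), such that $\int_{\mathcal{K}}g\,d\nu_i=\int_\Omega g(\omega,\beta_i(\omega))\,dm$ for every continuous $g\colon\Omega\times\mathbb{R}\to\mathbb{R}$ and $i\in\{1,2,3\}$, and $\beta_1(\omega)<\beta_2(\omega)<\beta_3(\omega)$ for $m$-almost every $\omega\in\Omega$; and the Lyapunov exponents satisfy $$\int_{\mathcal{K}}f_x\,d\nu_1<0,\qquad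 \int_{\mathcal{K}}f_x\,d\nu_2>0,\qquad \int_{\mathcal{K}}f_x\,d\nu_3<0.$$ -/

import Mathlib

open MeasureTheory Set

noncomputable section

namespace SkewFlow

variable {Ω : Type*}

/-- The partial derivative `f_x(ω, x)` with respect to the real variable. -/
def fx (f : Ω × ℝ → ℝ) (p : Ω × ℝ) : ℝ :=
  deriv (fun y => f (p.1, y)) p.2

/-- `f ∈ C^{0,1}(Ω × ℝ, ℝ)`: `f` is jointly continuous, and `f_x` exists everywhere and is
jointly continuous. -/
def IsC01 [TopologicalSpace Ω] (f : Ω × ℝ → ℝ) : Prop :=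
  Continuous f ∧ (∀ ω x, DifferentiableAt ℝ (fun y => f (ω, y)) x) ∧ Continuous (fx f)

section LocalFlow

variable [TopologicalSpace Ω]

/-- `v` solves `x' = f(ω·t, x)`, `x(0) = x₀`, on the open interval `I ∋ 0`. -/
def IsSolutionOn (σ : Flow ℝ Ω) (f : Ω × ℝ → ℝ) (ω : Ω) (x₀ : ℝ) (v : ℝ → ℝ) (I : Set ℝ) : Prop :=
  IsOpen I ∧ I.OrdConnected ∧ (0 : ℝ) ∈ I ∧ v 0 = x₀ ∧
    ∀ t ∈ I, HasDerivAt v (f (σ t ω, v t)) t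

/-- The domain `I_{ω,x₀}` of the maximal solution: all times reached by some solution. -/
def maxInterval (σ : Flow ℝ Ω) (f : Ω × ℝ → ℝ) (ω : Ω) (x₀ : ℝ) : Set ℝ :=
  {t | ∃ v : ℝ → ℝ, ∃ I : Set ℝ, IsSolutionOn σ f ω x₀ v I ∧ t ∈ I}

open Classical in
/-- The maximal solution `t ↦ u(t, ω, x₀)`. For `f ∈ C^{0,1}` all solutions of an initial value
problem agree on common intervals, so that the value is independent of the choice; outside
`maxInterval` the value is a dummy. -/
def u (σ : Flow ℝ Ω) (f : Ω × ℝ → ℝ) (t : ℝ) (ω : Ω) (x₀ : ℝ) : ℝ :=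
  if h : t ∈ maxInterval σ f ω x₀ then h.choose t else 0

/-- The local skewproduct flow `τ(t, ω, x) = (ω·t, u(t, ω, x))`. -/
def tau (σ : Flow ℝ Ω) (f : Ω × ℝ → ℝ) (t : ℝ) (p : Ω × ℝ) : Ω × ℝ :=
  (σ t p.1, u σ f t p.1 p.2)

/-- `K` is `τ`-invariant: it is composed of globally defined `τ`-orbits. -/
def IsTauInvariant (σ : Flow ℝ Ω) (f : Ω × ℝ → ℝ) (K : Set (Ω × ℝ)) : Prop :=
  ∀ p ∈ K, ∀ t : ℝ, t ∈ maxInterval σ f p.1 p.2 ∧ tau σ f t p ∈ K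

/-- The restriction of `τ` to a `τ`-invariant set. -/
def tauOn {σ : Flow ℝ Ω} {f : Ω × ℝ → ℝ} {K : Set (Ω × ℝ)} (hK : IsTauInvariant σ f K)
    (t : ℝ) (p : K) : K :=
  ⟨tau σ f t p.1, (hK p.1 p.2 t).2⟩

/-- `β : Ω → ℝ` is a `τ`-equilibrium. -/
def IsEquilibrium (σ : Flow ℝ Ω) (f : Ω × ℝ → ℝ) (β : Ω → ℝ) : Prop :=
  ∀ ω t, t ∈ maxInterval σ f ω (β ω) ∧ β (σ t ω) = u σ f t ω (β ω)

end LocalFlow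

/-- `μ` is an ergodic (normalized, invariant) measure for the family of maps `φ t`, `t ∈ ℝ`. -/
def IsErgodicMeasure {X : Type*} [MeasurableSpace X] (φ : ℝ → X → X) (μ : Measure X) : Prop :=
  IsProbabilityMeasure μ ∧
  (∀ t : ℝ, ∀ B : Set X, MeasurableSet B → μ (φ t '' B) = μ B) ∧
  ∀ B : Set X, MeasurableSet B → (∀ t : ℝ, φ t '' B = B) → μ B = 0 ∨ μ B = 1

/-- The `τ`-ergodic measures concentrated on `K` (Borel measures on `K`) projecting onto `m`. -/
def ergodicMeasuresOver [TopologicalSpace Ω] [MeasurableSpace Ω] {σ : Flow ℝ Ω} {f : Ω × ℝ → ℝ}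
    {K : Set (Ω × ℝ)} (hK : IsTauInvariant σ f K) (m : Measure Ω) : Set (Measure K) :=
  {ν | IsErgodicMeasure (tauOn hK) ν ∧ ν.map (fun p : K => p.1.1) = m}

/-- The Lyapunov exponent of `K` with respect to `ν`. -/
def lyapunov [MeasurableSpace Ω] (f : Ω × ℝ → ℝ) {K : Set (Ω × ℝ)} (ν : Measure K) : ℝ :=
  ∫ p : K, fx f p.1 ∂ν

/-- `β` is an `m`-measurable equilibrium with graph contained in `K` which represents `ν`:
`∫_K g dν = ∫_Ω g(ω, β(ω)) dm` for every continuous `g`. Being `m`-measurable means being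
measurable with respect to the `m`-completion of the Borel sets. -/
def Represents [TopologicalSpace Ω] [MeasurableSpace Ω] (σ : Flow ℝ Ω) (f : Ω × ℝ → ℝ)
    (m : Measure Ω) {K : Set (Ω × ℝ)} (β : Ω → ℝ) (ν : Measure K) : Prop :=
  IsEquilibrium σ f β ∧ NullMeasurable β m ∧ (∀ ω, (ω, β ω) ∈ K) ∧
    ∀ g : Ω × ℝ → ℝ, Continuous g → ∫ p : K, g p.1 ∂ν = ∫ ω, g (ω, β ω) ∂m

/-- d-concavity: `f_x(ω, ·)` is concave on `ℝ` for all `ω`. -/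
def IsDC (f : Ω × ℝ → ℝ) : Prop :=
  ∀ ω, ConcaveOn ℝ univ (fun x => fx f (ω, x))

/-- The length `l(J)` of a compact interval. -/
def len (J : Set ℝ) : ℝ := sSup J - sInf J

/-- The standardized `ε`-module of d-concavity `b_{J,ε}` of `f` on the compact interval `J`; the
infimum is a minimum for `f ∈ C^{0,1}` and `0 < ε ≤ l(J)`. -/
def stdModule (f : Ω × ℝ → ℝ) (J : Set ℝ) (ε : ℝ) (ω : Ω) : ℝ :=
  ε / (4 * len J ^ 2) *
    sInf ((fun x => 2 * fx f (ω, x) - fx f (ω, x - ε / 2) - fx f (ω, x + ε / 2)) ''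
      {x | Icc (x - ε / 2) (x + ε / 2) ⊆ J})

/-- `f` is strictly d-concave with respect to `m` on the compact interval `J`. -/
def IsSDCOn [MeasurableSpace Ω] (f : Ω × ℝ → ℝ) (m : Measure Ω) (J : Set ℝ) : Prop :=
  IsDC f ∧ ∃ ρ : ℝ, 0 < ρ ∧ ∀ ε : ℝ, 0 < ε → ε ≤ len J / 2 →
    ENNReal.ofReal ρ < m {ω | 0 < stdModule f J ε ω}

/-- The variation interval `J_K` of a compact set `K`. -/
def variationInterval (K : Set (Ω × ℝ)) : Set ℝ :=
  Icc (sInf (Prod.snd '' K)) (sSup (Prod.snd '' K))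

end SkewFlow

end

namespace SkewFlow

open Filter Topology NNReal ProbabilityTheory

/-! ### Solutions and the flow on an invariant compact set. -/

section Trajectories

variable {Ω : Type*} [TopologicalSpace Ω] [CompactSpace Ω] {σ : Flow ℝ Ω} {f : Ω × ℝ → ℝ}

/-! The proof combines a structure result for ergodic measures with an interpolation inequality.

Structure (`exists_equilibrium`): disintegrate an ergodic `ν` over `m` into fibre measures `κ ω`.
The fibre maps of `τ` are increasing, so `κ ω (Iic x)` is invariant along orbits up to null sets,
and its sublevel sets are `ν`-null or full. A distribution function is at most `s` only on a set of
mass at most `s`; hence it equals 1 almost everywhere, and so does `κ ω (Ici x)`. The fibre measures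
are therefore Dirac masses, and `ν` lives on the graph of an equilibrium.

Signs (`lyapunov_signs`): for equilibria `α < β`, the divided difference of `f` between them is the
derivative of `log (β - α)` along the flow, so its mean is zero. Given `β₁ < β₂ < β₃`, interpolate
`f (ω, ·)` at these nodes by a quadratic `P`. At the nodes `P'` is a signed sum of divided
differences, again of zero mean. By Rolle the concave function `f_x - P'` vanishes between
consecutive nodes, so it is nonpositive at the outer nodes and nonnegative at the middle one. Strict
d-concavity makes this strict with positive probability: the exponents have signs -, +, -.

Ergodicity orders distinct equilibria almost everywhere. With four measures, the second would be the
middle of one triple and the bottom of another, which gives its exponent both signs. -/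

theorem IsC01.exists_lipschitzOnWith (hf : IsC01 f) (R : ℝ) :
    ∃ L : ℝ≥0, 0 < L ∧ (∀ ω, LipschitzOnWith L (fun x => f (ω, x)) (Icc (-R) R)) ∧
      ∀ ω, ∀ x ∈ Icc (-R) R, |fx f (ω, x)| ≤ L := by
  obtain ⟨C, hC⟩ := ((isCompact_univ (X := Ω)).prod (isCompact_Icc (a := -R) (b := R))).exists_bound_of_continuousOn
    hf.2.2.continuousOn
  have hb : ∀ ω, ∀ x ∈ Icc (-R) R, |fx f (ω, x)| ≤ (Real.toNNReal C + 1 : ℝ≥0) := fun ω x hx =>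
    (hC (ω, x) ⟨mem_univ _, hx⟩).trans
      ((Real.le_coe_toNNReal C).trans (by push_cast; linarith))
  -- The added 1 keeps the constant positive; the closed Grönwall formula divides by it.
  refine ⟨Real.toNNReal C + 1, by positivity, fun ω => ?_, hb⟩
  exact (convex_Icc (-R) R).lipschitzOnWith_of_nnnorm_deriv_le (fun x _ => hf.2.1 ω x)
    (fun x hx => hb ω x hx)

/-- Two solutions of the same scalar initial value problem agree on common open intervals. -/
theorem solution_unique (hf : IsC01 f) {ω : Ω} {v w : ℝ → ℝ} {a b c : ℝ}
    (hc : c ∈ Icc a b)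
    (hv : ∀ t ∈ Icc a b, HasDerivAt v (f (σ t ω, v t)) t)
    (hw : ∀ t ∈ Icc a b, HasDerivAt w (f (σ t ω, w t)) t) (h : v c = w c) :
    EqOn v w (Icc a b) := by
  have cv : ContinuousOn v (Icc a b) := HasDerivAt.continuousOn hv
  have cw : ContinuousOn w (Icc a b) := HasDerivAt.continuousOn hw
  obtain ⟨R₁, h₁⟩ := isCompact_Icc.exists_bound_of_continuousOn cv
  obtain ⟨R₂, h₂⟩ := isCompact_Icc.exists_bound_of_continuousOn cw
  obtain ⟨L, -, hL, -⟩ := hf.exists_lipschitzOnWith (max R₁ R₂)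
  have m₁ : ∀ t ∈ Icc a b, v t ∈ Icc (-max R₁ R₂) (max R₁ R₂) := fun t ht =>
    abs_le.1 ((h₁ t ht).trans (le_max_left _ _))
  have m₂ : ∀ t ∈ Icc a b, w t ∈ Icc (-max R₁ R₂) (max R₁ R₂) := fun t ht =>
    abs_le.1 ((h₂ t ht).trans (le_max_right _ _))
  rw [← Icc_union_Icc_eq_Icc hc.1 hc.2]
  have s₁ : Icc a c ⊆ Icc a b := Icc_subset_Icc_right hc.2
  have s₂ : Icc c b ⊆ Icc a b := Icc_subset_Icc_left hc.1
  apply EqOn.union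
  · exact ODE_solution_unique_of_mem_Icc_left (v := fun t x => f (σ t ω, x))
      (s := fun _ => Icc (-max R₁ R₂) (max R₁ R₂)) (K := L) (fun t _ => hL _) (cv.mono s₁)
      (fun t ht => (hv t (s₁ (Ioc_subset_Icc_self ht))).hasDerivWithinAt)
      (fun t ht => m₁ t (s₁ (Ioc_subset_Icc_self ht))) (cw.mono s₁)
      (fun t ht => (hw t (s₁ (Ioc_subset_Icc_self ht))).hasDerivWithinAt)
      (fun t ht => m₂ t (s₁ (Ioc_subset_Icc_self ht))) h
  · exact ODE_solution_unique_of_mem_Icc_right (v := fun t x => f (σ t ω, x))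
      (s := fun _ => Icc (-max R₁ R₂) (max R₁ R₂)) (K := L) (fun t _ => hL _) (cv.mono s₂)
      (fun t ht => (hv t (s₂ (Ico_subset_Icc_self ht))).hasDerivWithinAt)
      (fun t ht => m₁ t (s₂ (Ico_subset_Icc_self ht))) (cw.mono s₂)
      (fun t ht => (hw t (s₂ (Ico_subset_Icc_self ht))).hasDerivWithinAt)
      (fun t ht => m₂ t (s₂ (Ico_subset_Icc_self ht))) h

/-- Any solution on an interval coincides there with the maximal solution. -/
theorem IsSolutionOn.u_eq (hf : IsC01 f) {ω : Ω} {x₀ : ℝ} {v : ℝ → ℝ} {I : Set ℝ}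
    (hv : IsSolutionOn σ f ω x₀ v I) {t : ℝ} (ht : t ∈ I) : u σ f t ω x₀ = v t := by
  have hmem : t ∈ maxInterval σ f ω x₀ := ⟨v, I, hv, ht⟩
  rw [u, dif_pos hmem]
  obtain ⟨I', hw, ht'⟩ := hmem.choose_spec
  generalize hmem.choose = w at *
  obtain ⟨-, hI, h0, hv0, hvd⟩ := hv
  obtain ⟨-, hI', h0', hw0, hwd⟩ := hw
  have k : uIcc 0 t ⊆ I := hI.uIcc_subset h0 ht
  have k' : uIcc 0 t ⊆ I' := hI'.uIcc_subset h0' ht'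
  exact solution_unique hf (c := 0) left_mem_uIcc (fun s hs => hwd s (k' hs))
    (fun s hs => hvd s (k hs)) (hw0.trans hv0.symm) right_mem_uIcc

theorem hasDerivAt_u (hf : IsC01 f) {ω : Ω} {x₀ t : ℝ} (ht : t ∈ maxInterval σ f ω x₀) :
    HasDerivAt (fun s => u σ f s ω x₀) (f (σ t ω, u σ f t ω x₀)) t := by
  obtain ⟨v, I, hv, hI⟩ := ht
  rw [hv.u_eq hf hI]
  refine (hv.2.2.2.2 t hI).congr_of_eventuallyEq ?_
  filter_upwards [hv.1.mem_nhds hI] with s hs using hv.u_eq hf hs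

theorem u_zero (hf : IsC01 f) {ω : Ω} {x₀ : ℝ} (h : (0 : ℝ) ∈ maxInterval σ f ω x₀) :
    u σ f 0 ω x₀ = x₀ := by
  obtain ⟨v, I, hv, hI⟩ := h
  rw [hv.u_eq hf hI, hv.2.2.2.1]

variable {K : Set (Ω × ℝ)} (hK : IsTauInvariant σ f K)
include hK

theorem IsTauInvariant.hasDerivAt_u (hf : IsC01 f) {p : Ω × ℝ} (hp : p ∈ K) (t : ℝ) :
    HasDerivAt (fun s => u σ f s p.1 p.2) (f (tau σ f t p)) t :=
  SkewFlow.hasDerivAt_u hf (hK p hp t).1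

theorem IsTauInvariant.tau_zero (hf : IsC01 f) {p : Ω × ℝ} (hp : p ∈ K) : tau σ f 0 p = p :=
  Prod.ext (by simp [tau]) (u_zero hf (hK p hp 0).1)

theorem IsTauInvariant.tau_add (hf : IsC01 f) {p : Ω × ℝ} (hp : p ∈ K) (s t : ℝ) :
    tau σ f (s + t) p = tau σ f s (tau σ f t p) := by
  refine Prod.ext (σ.map_add s t p.1) ?_
  have h₁ : ∀ r : ℝ, HasDerivAt (fun r => u σ f (r + t) p.1 p.2)
      (f (σ r (σ t p.1), u σ f (r + t) p.1 p.2)) r := fun r => by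
    have := (hK.hasDerivAt_u hf hp (r + t)).comp_add_const r t
    simpa [tau, σ.map_add] using this
  have h₂ : ∀ r : ℝ, HasDerivAt (fun r => u σ f r (σ t p.1) (u σ f t p.1 p.2))
      (f (σ r (σ t p.1), u σ f r (σ t p.1) (u σ f t p.1 p.2))) r := fun r =>
    hK.hasDerivAt_u hf (hK p hp t).2 r
  refine solution_unique hf (σ := σ) (ω := σ t p.1) (a := min 0 s) (b := max 0 s) (c := 0)
    (by simp) (fun r _ => h₁ r) (fun r _ => h₂ r) ?_ (by simp : s ∈ _)
  have := congrArg Prod.snd (hK.tau_zero hf (hK p hp t).2)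
  simpa [tau] using this.symm

theorem IsTauInvariant.tau_neg_tau (hf : IsC01 f) {p : Ω × ℝ} (hp : p ∈ K) (t : ℝ) :
    tau σ f (-t) (tau σ f t p) = p := by
  rw [← hK.tau_add hf hp, neg_add_cancel, hK.tau_zero hf hp]

theorem IsTauInvariant.continuous_u (hf : IsC01 f) {p : Ω × ℝ} (hp : p ∈ K) :
    Continuous fun t => u σ f t p.1 p.2 :=
  continuous_iff_continuousAt.2 fun t => (hK.hasDerivAt_u hf hp t).continuousAt

/-- The fibre maps of `τ` are strictly increasing on an invariant set. -/
theorem IsTauInvariant.u_lt_u (hf : IsC01 f) {ω : Ω} {x y : ℝ} (hx : (ω, x) ∈ K)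
    (hy : (ω, y) ∈ K) (hxy : x < y) (t : ℝ) : u σ f t ω x < u σ f t ω y := by
  by_contra! hcon
  have hc : Continuous fun t => u σ f t ω y - u σ f t ω x :=
    (hK.continuous_u hf hy).sub (hK.continuous_u hf hx)
  have x0 : u σ f 0 ω x = x := u_zero hf (hK _ hx 0).1
  have y0 : u σ f 0 ω y = y := u_zero hf (hK _ hy 0).1
  obtain ⟨s, hs⟩ : (0 : ℝ) ∈ range fun t => u σ f t ω y - u σ f t ω x :=
    mem_range_of_exists_le_of_exists_ge hc ⟨t, by linarith⟩ ⟨0, by simp only [x0, y0]; linarith⟩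
  have : tau σ f s (ω, x) = tau σ f s (ω, y) :=
    Prod.ext rfl (by simp only [tau] at *; linarith)
  have h2 := hK.tau_neg_tau hf hx s
  rw [this, hK.tau_neg_tau hf hy s] at h2
  exact hxy.ne' (congrArg Prod.snd h2)

theorem IsTauInvariant.u_le_u_iff (hf : IsC01 f) {ω : Ω} {x y : ℝ} (hx : (ω, x) ∈ K)
    (hy : (ω, y) ∈ K) (t : ℝ) : u σ f t ω x ≤ u σ f t ω y ↔ x ≤ y := by
  refine ⟨fun h => not_lt.1 fun h' => (hK.u_lt_u hf hy hx h' t).not_ge h, fun h => ?_⟩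
  rcases h.eq_or_lt with rfl | h
  · rfl
  · exact (hK.u_lt_u hf hx hy h t).le

omit [CompactSpace Ω] hK in
theorem exists_abs_snd_le (hKc : IsCompact K) : ∃ R, ∀ p ∈ K, p.2 ∈ Icc (-R) R := by
  obtain ⟨R, hR⟩ := hKc.exists_bound_of_continuousOn continuous_snd.continuousOn
  exact ⟨R, fun p hp => abs_le.1 (hR p hp)⟩

theorem tauOn_zero (hf : IsC01 f) (p : K) : tauOn hK 0 p = p :=
  Subtype.ext (hK.tau_zero hf p.2)

theorem tauOn_add (hf : IsC01 f) (s t : ℝ) (p : K) :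
    tauOn hK (s + t) p = tauOn hK s (tauOn hK t p) :=
  Subtype.ext (hK.tau_add hf p.2 s t)

/-- Grönwall: a solution over a nearby base point solves the original equation up to an error that
is uniformly small on the compact set `[0, t] × [-R, R]`, and invariance keeps both solutions in
`[-R, R]`. -/
theorem continuous_tauOn_of_nonneg (hf : IsC01 f) (hKc : IsCompact K) {t : ℝ} (ht : 0 ≤ t) :
    Continuous (tauOn hK t) := by
  obtain ⟨R, hR⟩ := exists_abs_snd_le hKc
  obtain ⟨L, hL0, hL, -⟩ := hf.exists_lipschitzOnWith R
  have hL0' : (0 : ℝ) < L := hL0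
  have h1 : Continuous fun p : K => σ t p.1.1 :=
    (σ.continuous continuous_const continuous_id).comp (continuous_fst.comp continuous_subtype_val)
  have h2 : Continuous fun p : K => u σ f t p.1.1 p.1.2 := by
    rw [continuous_iff_continuousAt]
    intro p
    rw [ContinuousAt, Metric.tendsto_nhds]
    intro η hη
    -- With initial distance and defect both at most `ε`, the Grönwall bound is at most `ε * C`.
    set C : ℝ := Real.exp (L * t) + 1 / L * Real.exp (L * t) with hC
    have hC0 : 0 < C := by positivity
    set ε : ℝ := η / (2 * C) with hε
    have hε0 : 0 < ε := by positivity
    have e1 : ∀ᶠ q : K in 𝓝 p, dist p.1.2 q.1.2 < ε := by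
      have : Tendsto (fun q : K => dist p.1.2 q.1.2) (𝓝 p) (𝓝 (dist p.1.2 p.1.2)) :=
        Continuous.tendsto (by fun_prop) p
      rw [dist_self] at this
      exact this.eventually_lt_const hε0
    have e2 : ∀ᶠ q : K in 𝓝 p, ∀ z ∈ Icc 0 t ×ˢ Icc (-R) R,
        dist (f (σ z.1 q.1.1, z.2)) (f (σ z.1 p.1.1, z.2)) < ε := by
      apply (isCompact_Icc.prod isCompact_Icc).eventually_forall_of_forall_eventually
      intro z _
      have c1 : Continuous fun w : K × (ℝ × ℝ) => f (σ w.2.1 w.1.1.1, w.2.2) :=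
        hf.1.comp ((σ.continuous (by fun_prop) (by fun_prop)).prodMk (by fun_prop))
      have c2 : Continuous fun w : K × (ℝ × ℝ) => f (σ w.2.1 p.1.1, w.2.2) :=
        hf.1.comp ((σ.continuous (by fun_prop) (by fun_prop)).prodMk (by fun_prop))
      have := (c1.dist c2).tendsto (p, z)
      simp only [dist_self] at this
      exact this.eventually_lt_const hε0
    filter_upwards [e1, e2] with q hq1 hq2
    have key := dist_le_of_approx_trajectories_ODE_of_mem (v := fun r x => f (σ r p.1.1, x))
      (s := fun _ => Icc (-R) R) (K := L) (f := fun r => u σ f r p.1.1 p.1.2)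
      (g := fun r => u σ f r q.1.1 q.1.2) (f' := fun r => f (tau σ f r p.1))
      (g' := fun r => f (tau σ f r q.1)) (a := 0) (b := t) (εf := 0) (εg := ε) (δ := ε)
      (fun r _ => hL _) (hK.continuous_u hf p.2).continuousOn
      (fun r _ => (hK.hasDerivAt_u hf p.2 r).hasDerivWithinAt)
      (fun r _ => by simp [tau]) (fun r _ => hR _ (hK _ p.2 r).2)
      (hK.continuous_u hf q.2).continuousOn
      (fun r _ => (hK.hasDerivAt_u hf q.2 r).hasDerivWithinAt)
      (fun r hr => (hq2 (r, _) ⟨Ico_subset_Icc_self hr, hR _ (hK _ q.2 r).2⟩).le)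
      (fun r _ => hR _ (hK _ q.2 r).2)
      (by rw [u_zero hf (hK _ p.2 0).1, u_zero hf (hK _ q.2 0).1]; exact hq1.le) t ⟨ht, le_rfl⟩
    rw [dist_comm]
    refine key.trans_lt ?_
    rw [gronwallBound_of_K_ne_0 hL0'.ne']
    simp only [zero_add, sub_zero]
    calc _ = ε * (Real.exp (L * t) + 1 / L * (Real.exp (L * t) - 1)) := by ring
      _ ≤ ε * C := by rw [hC]; gcongr; linarith
      _ < η := by rw [hε]; field_simp; linarith
  exact (h1.prodMk h2).subtype_mk _

/-- Negative times come for free: the inverse of a continuous bijection of a compact Hausdorff space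
is continuous. -/
theorem continuous_tauOn [T2Space Ω] (hf : IsC01 f) (hKc : IsCompact K) (t : ℝ) :
    Continuous (tauOn hK t) := by
  have := isCompact_iff_compactSpace.1 hKc
  rcases le_total 0 t with ht | ht
  · exact continuous_tauOn_of_nonneg hK hf hKc ht
  · let e : K ≃ K :=
      { toFun := tauOn hK (-t)
        invFun := tauOn hK t
        left_inv := fun p => by rw [← tauOn_add hK hf, add_neg_cancel, tauOn_zero hK hf]
        right_inv := fun p => by rw [← tauOn_add hK hf, neg_add_cancel, tauOn_zero hK hf] }
    exact Continuous.continuous_symm_of_equiv_compact_to_t2 (f := e)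
      (continuous_tauOn_of_nonneg hK hf hKc (by linarith))

theorem continuous_tauOn_time (hf : IsC01 f) (p : K) : Continuous fun t => tauOn hK t p :=
  ((σ.continuous continuous_id continuous_const).prodMk (hK.continuous_u hf p.2)).subtype_mk _

end Trajectories

/-- A jointly measurable action of `ℝ`. -/
structure IsMeasurableFlow {X : Type*} [MeasurableSpace X] (φ : ℝ → X → X) : Prop where
  zero : ∀ x, φ 0 x = x
  add : ∀ s t x, φ (s + t) x = φ s (φ t x)
  measurable : Measurable fun z : ℝ × X => φ z.1 z.2

/-- The points whose orbit lies in `B` for almost every time. -/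
def orbitCore {X : Type*} (φ : ℝ → X → X) (B : Set X) : Set X :=
  {x | ∀ᵐ t : ℝ, φ t x ∈ B}

/-! ### Almost invariant sets and the zero-one law. -/

section MeasurableFlow

variable {X : Type*} [MeasurableSpace X] {φ : ℝ → X → X} (hφ : IsMeasurableFlow φ)
  {μ : Measure X} {B : Set X}
include hφ

namespace IsMeasurableFlow

theorem measurable_time (t : ℝ) : Measurable (φ t) :=
  hφ.measurable.comp (measurable_const.prodMk measurable_id)

theorem neg_apply (t : ℝ) (x : X) : φ (-t) (φ t x) = x := by
  rw [← hφ.add, neg_add_cancel, hφ.zero]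

theorem apply_neg (t : ℝ) (x : X) : φ t (φ (-t) x) = x := by
  rw [← hφ.add, add_neg_cancel, hφ.zero]

theorem image_eq (t : ℝ) (B : Set X) : φ t '' B = φ (-t) ⁻¹' B :=
  congrFun (image_eq_preimage_of_inverse (hφ.neg_apply t) (hφ.apply_neg t)) B

theorem measurePreserving (hμ : IsErgodicMeasure φ μ) (t : ℝ) : MeasurePreserving (φ t) μ μ := by
  refine ⟨hφ.measurable_time t, Measure.ext fun B hB => ?_⟩
  rw [Measure.map_apply (hφ.measurable_time t) hB, ← hμ.2.1 (-t) B hB, hφ.image_eq, neg_neg]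

theorem measurableSet_orbitCore (hB : MeasurableSet B) : MeasurableSet (orbitCore φ B) := by
  have hS : MeasurableSet {z : X × ℝ | φ z.2 z.1 ∈ Bᶜ} :=
    (hφ.measurable.comp measurable_swap) hB.compl
  exact (measurable_measure_prodMk_left (ν := (volume : Measure ℝ)) hS)
    (measurableSet_singleton 0)

theorem mem_orbitCore_iff (t : ℝ) (x : X) : φ t x ∈ orbitCore φ B ↔ x ∈ orbitCore φ B := by
  have key : ∀ (t : ℝ) (x : X), x ∈ orbitCore φ B → φ t x ∈ orbitCore φ B := fun t x hx => by
    have := (measurePreserving_add_right (volume : Measure ℝ) t).quasiMeasurePreserving.ae hx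
    filter_upwards [this] with s hs
    rwa [← hφ.add]
  refine ⟨fun h => ?_, key t x⟩
  have := key (-t) _ h
  rwa [hφ.neg_apply] at this

theorem image_orbitCore (t : ℝ) : φ t '' orbitCore φ B = orbitCore φ B := by
  rw [hφ.image_eq]
  ext x
  exact hφ.mem_orbitCore_iff (-t) x

/-- Ergodicity is stated for strictly invariant sets only. Fubini exchanges "for each time, almost
every point" with "for almost every point, almost every time", so an almost invariant set agrees
almost everywhere with its strictly invariant orbit core. -/
theorem ae_mem_orbitCore_iff [SFinite μ] (hB : MeasurableSet B)
    (h : ∀ t : ℝ, ∀ᵐ x ∂μ, (φ t x ∈ B ↔ x ∈ B)) : ∀ᵐ x ∂μ, (x ∈ orbitCore φ B ↔ x ∈ B) := by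
  have hS : MeasurableSet {z : ℝ × X | φ z.1 z.2 ∈ B ↔ z.2 ∈ B} :=
    MeasurableSet.iff (hφ.measurable hB) (measurable_snd hB)
  have h' : ∀ᵐ x ∂μ, ∀ᵐ t : ℝ, (φ t x ∈ B ↔ x ∈ B) :=
    (Measure.ae_ae_comm (μ := (volume : Measure ℝ)) (ν := μ) hS).1 (ae_of_all _ h)
  filter_upwards [h'] with x hx
  constructor
  · intro hc
    obtain ⟨t, h₁, h₂⟩ := (hx.and hc).exists
    exact h₁.1 h₂
  · intro hxB
    filter_upwards [hx] with t ht using ht.2 hxB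

theorem measure_eq_zero_or_one (hμ : IsErgodicMeasure φ μ) (hB : MeasurableSet B)
    (h : ∀ t : ℝ, ∀ᵐ x ∂μ, (φ t x ∈ B ↔ x ∈ B)) : μ B = 0 ∨ μ B = 1 := by
  have := hμ.1
  have e : μ B = μ (orbitCore φ B) :=
    measure_congr (eventuallyEq_set.2 ((hφ.ae_mem_orbitCore_iff hB h).mono fun x hx => hx.symm))
  rw [e]
  exact hμ.2.2 _ (hφ.measurableSet_orbitCore hB) hφ.image_orbitCore

theorem ae_mem_orbitCore (hμ : IsErgodicMeasure φ μ) (hB : MeasurableSet B)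
    (h : ∀ᵐ x ∂μ, x ∈ B) : ∀ᵐ x ∂μ, x ∈ orbitCore φ B := by
  have := hμ.1
  have h' : ∀ t : ℝ, ∀ᵐ x ∂μ, (φ t x ∈ B ↔ x ∈ B) := fun t => by
    filter_upwards [h, (hφ.measurePreserving hμ t).quasiMeasurePreserving.ae h] with x h1 h2
    exact iff_of_true h2 h1
  filter_upwards [h, hφ.ae_mem_orbitCore_iff hB h'] with x h1 h2 using h2.2 h1

end IsMeasurableFlow

end MeasurableFlow

/-! ### Distribution functions evaluated at their own random variable. -/

section Distribution

variable (μ : Measure ℝ) [IsFiniteMeasure μ] (s : ENNReal)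

/-- The set is a lower set. A nonempty compact part of it lies in `Iic a`, where `a` is its own
maximum and so satisfies the defining bound; inner regularity concludes. -/
theorem measure_setOf_measure_Iic_le : μ {x | μ (Iic x) ≤ s} ≤ s := by
  have hL : IsLowerSet {x | μ (Iic x) ≤ s} := fun x y hyx hx =>
    (measure_mono (Iic_subset_Iic.2 hyx)).trans hx
  rw [hL.ordConnected.measurableSet.measure_eq_iSup_isCompact]
  refine iSup₂_le fun C hC => iSup_le fun hCc => ?_
  rcases C.eq_empty_or_nonempty with rfl | hne
  · simp
  · obtain ⟨a, ha, hmax⟩ := hCc.exists_isGreatest hne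
    exact (measure_mono fun x hx => hmax hx).trans (hC ha)

theorem measure_setOf_measure_Ici_le : μ {x | μ (Ici x) ≤ s} ≤ s := by
  have hL : IsUpperSet {x | μ (Ici x) ≤ s} := fun x y hyx hx =>
    (measure_mono (Ici_subset_Ici.2 hyx)).trans hx
  rw [hL.ordConnected.measurableSet.measure_eq_iSup_isCompact]
  refine iSup₂_le fun C hC => iSup_le fun hCc => ?_
  rcases C.eq_empty_or_nonempty with rfl | hne
  · simp
  · obtain ⟨a, ha, hmin⟩ := hCc.exists_isLeast hne
    exact (measure_mono fun x hx => hmin hx).trans (hC ha)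

end Distribution

theorem ae_eq_of_compProd_eq {Ω : Type*} [MeasurableSpace Ω] {m : Measure Ω}
    [IsProbabilityMeasure m] {κ η : Kernel Ω ℝ} [IsMarkovKernel κ] [IsMarkovKernel η]
    (h : m ⊗ₘ κ = m ⊗ₘ η) : ∀ᵐ ω ∂m, κ ω = η ω := by
  have hfst : (m ⊗ₘ κ).fst = m := Measure.fst_compProd m κ
  have h₁ := eq_condKernel_of_measure_eq_compProd (ρ := m ⊗ₘ κ) κ (by rw [hfst])
  have h₂ := eq_condKernel_of_measure_eq_compProd (ρ := m ⊗ₘ κ) η (by rw [hfst, h])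
  rw [hfst] at h₁ h₂
  filter_upwards [h₁, h₂] with ω e₁ e₂ using e₁.trans e₂.symm

/-! ### Fibre measures of an ergodic measure. -/

section Disintegration

variable {Ω : Type*} [MetricSpace Ω] [CompactSpace Ω] [MeasurableSpace Ω] [BorelSpace Ω]
  {σ : Flow ℝ Ω} {f : Ω × ℝ → ℝ} {m : Measure Ω} {K : Set (Ω × ℝ)}

theorem isMeasurableFlow_base (σ : Flow ℝ Ω) : IsMeasurableFlow fun t ω => σ t ω where
  zero := σ.map_zero_apply
  add := σ.map_add
  measurable := σ.cont'.measurable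

theorem isMeasurableFlow_tauOn (hf : IsC01 f) (hKc : IsCompact K) (hK : IsTauInvariant σ f K) :
    IsMeasurableFlow (tauOn hK) where
  zero := tauOn_zero hK hf
  add := tauOn_add hK hf
  measurable := measurable_uncurry_of_continuous_of_measurable (u := tauOn hK)
    (fun p => continuous_tauOn_time hK hf p) (fun t => (continuous_tauOn hK hf hKc t).measurable)

variable (hf : IsC01 f) (hm : IsErgodicMeasure (fun t ω => σ t ω) m)
  (hKc : IsCompact K) (hK : IsTauInvariant σ f K) {ν : Measure K}
  (hν : IsErgodicMeasure (tauOn hK) ν) {κ : Kernel Ω ℝ} [IsMarkovKernel κ]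
  (hκ : ν.map Subtype.val = m ⊗ₘ κ)
include hf hm hKc hK hκ

omit hf hK in
theorem ae_ae_mem_of_disintegration : ∀ᵐ ω ∂m, ∀ᵐ y ∂κ ω, (ω, y) ∈ K := by
  have := hm.1
  refine Measure.ae_ae_of_ae_compProd (p := fun z => z ∈ K) ?_
  rw [← hκ]
  refine (ae_map_iff measurable_subtype_coe.aemeasurable hKc.measurableSet).2 ?_
  exact ae_of_all _ fun p => p.2

include hν in
/-- The conditional measures of an invariant measure on the fibres are equivariant. -/
theorem disintegration_equivariant (t : ℝ) {A : ℝ → Set ℝ} (hA : ∀ x, MeasurableSet (A x))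
    (hAm : ∀ ω x y, (ω, x) ∈ K → (ω, y) ∈ K → (u σ f t ω y ∈ A (u σ f t ω x) ↔ y ∈ A x)) :
    ∀ᵐ ω ∂m, ∀ x, (ω, x) ∈ K → κ (σ t ω) (A (u σ f t ω x)) = κ ω (A x) := by
  have := hm.1
  have hKm : MeasurableSet K := hKc.measurableSet
  have hΦ := isMeasurableFlow_tauOn hf hKc hK
  have hσ : Measurable fun ω => σ t ω := (isMeasurableFlow_base σ).measurable_time t
  have hσ' : Measurable fun ω => σ (-t) ω := (isMeasurableFlow_base σ).measurable_time (-t)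
  have mpσ := (isMeasurableFlow_base σ).measurePreserving hm t
  -- The fibre component of `τ` at time `-t`, set to 0 off `K`, because the kernels live on all of
  -- `ℝ`.
  set w : Ω × ℝ → ℝ := Function.extend Subtype.val (fun p : K => (tauOn hK (-t) p).1.2) 0
  have hw : Measurable w := (MeasurableEmbedding.subtype_coe hKm).measurable_extend
    ((measurable_snd.comp measurable_subtype_coe).comp (hΦ.measurable_time (-t))) measurable_const
  have hwK : ∀ p : K, w p.1 = (tauOn hK (-t) p).1.2 := fun p =>
    Subtype.val_injective.extend_apply _ _ p
  have hg : Measurable fun z : Ω × ℝ => w (σ t z.1, z.2) :=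
    hw.comp ((hσ.comp measurable_fst).prodMk measurable_snd)
  -- The fibre measure over `σ t ω`, pulled back to `ω`. Invariance of `ν` and of `m` makes it a
  -- second disintegration of `ν`, so it agrees with `κ` almost everywhere.
  set η : Kernel Ω ℝ := (Kernel.id ×ₖ κ.comap (fun ω => σ t ω) hσ).map
    (fun z : Ω × ℝ => w (σ t z.1, z.2)) with hη
  have : IsMarkovKernel η := Kernel.IsMarkovKernel.map _ hg
  have ηa : ∀ ω S, MeasurableSet S → η ω S = κ (σ t ω) {y | w (σ t ω, y) ∈ S} := fun ω S hS => by
    rw [hη, Kernel.map_apply' _ hg _ hS, Kernel.id_prod_apply' _ _ (hg hS), Kernel.comap_apply]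
    rfl
  have hcomp : m ⊗ₘ η = m ⊗ₘ κ := by
    ext S hS
    have hS' : MeasurableSet {z : Ω × ℝ | (σ (-t) z.1, w z) ∈ S} :=
      ((hσ'.comp measurable_fst).prodMk hw) hS
    rw [Measure.compProd_apply hS]
    have e : ∀ ω, η ω (Prod.mk ω ⁻¹' S) =
        (fun ω' => κ ω' (Prod.mk ω' ⁻¹' {z : Ω × ℝ | (σ (-t) z.1, w z) ∈ S})) (σ t ω) := fun ω => by
      rw [ηa _ _ (measurable_prodMk_left hS)]
      have : σ (-t) (σ t ω) = ω := (isMeasurableFlow_base σ).neg_apply t ω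
      simp only [preimage_ofPred_eq, this, mem_preimage]
    simp_rw [e]
    rw [mpσ.lintegral_comp (Kernel.measurable_kernel_prodMk_left hS'),
      ← Measure.compProd_apply hS', ← hκ, Measure.map_apply measurable_subtype_coe hS',
      Measure.map_apply measurable_subtype_coe hS]
    have e2 : (Subtype.val : K → Ω × ℝ) ⁻¹' {z : Ω × ℝ | (σ (-t) z.1, w z) ∈ S} =
        tauOn hK (-t) ⁻¹' (Subtype.val ⁻¹' S) := by
      ext p
      simp only [mem_preimage, mem_ofPred_eq, hwK p]
      rfl
    rw [e2, (hΦ.measurePreserving hν (-t)).measure_preimage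
      (measurable_subtype_coe hS).nullMeasurableSet]
  have hmem := ae_ae_mem_of_disintegration hm hKc hκ
  filter_upwards [ae_eq_of_compProd_eq hcomp, mpσ.quasiMeasurePreserving.ae hmem] with ω h₁ h₂ x hx
  rw [← h₁, ηa _ _ (hA x)]
  refine measure_congr (eventuallyEq_set.2 ?_)
  filter_upwards [h₂] with y hy
  have e3 := hwK ⟨(σ t ω, y), hy⟩
  have hq := (hK _ hy (-t)).2
  have hb := hK.tau_neg_tau hf hy (-t)
  simp only [neg_neg] at hb
  have hs : tau σ f (-t) (σ t ω, y) = (ω, w (σ t ω, y)) :=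
    Prod.ext ((isMeasurableFlow_base σ).neg_apply t ω) e3.symm
  rw [hs] at hq hb
  have := hAm ω x _ hx hq
  change y ∈ _ ↔ w (σ t ω, y) ∈ A x
  rw [← this, show u σ f t ω (w (σ t ω, y)) = y from congrArg Prod.snd hb]

include hν in
-- For each `s < 1` the points where the conditional mass is at most `s` form an almost invariant
-- set of measure at most `s`, hence a null set; then `s` tends to 1. It is applied to both families
-- of half-lines, `Iic` and `Ici`.
theorem ae_conditional_eq_one {A : ℝ → Set ℝ} (hA : MeasurableSet {z : ℝ × ℝ | z.2 ∈ A z.1})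
    (hAm : ∀ t ω x y, (ω, x) ∈ K → (ω, y) ∈ K → (u σ f t ω y ∈ A (u σ f t ω x) ↔ y ∈ A x))
    (hA' : ∀ μ : Measure ℝ, IsProbabilityMeasure μ → ∀ s, μ {x | μ (A x) ≤ s} ≤ s) :
    ∀ᵐ p ∂ν, κ p.1.1 (A p.1.2) = 1 := by
  have := hm.1
  have hΦ := isMeasurableFlow_tauOn hf hKc hK
  have hAx : ∀ x, MeasurableSet (A x) := fun x => measurable_prodMk_left hA
  have hF : Measurable fun z : Ω × ℝ => κ z.1 (A z.2) :=
    Kernel.measurable_kernel_prodMk_left (κ := κ.comap (Prod.fst : Ω × ℝ → Ω) measurable_fst)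
      (t := {z : (Ω × ℝ) × ℝ | z.2 ∈ A z.1.2})
      ((measurable_snd.comp measurable_fst).prodMk measurable_snd hA)
  obtain ⟨s, -, hs1, hs⟩ := exists_seq_strictMono_tendsto' (zero_lt_one (α := ENNReal))
  have key : ∀ n, ν {p : K | κ p.1.1 (A p.1.2) ≤ s n} = 0 := fun n => by
    have hSm : MeasurableSet {z : Ω × ℝ | κ z.1 (A z.2) ≤ s n} := hF measurableSet_Iic
    have hle : ν {p : K | κ p.1.1 (A p.1.2) ≤ s n} ≤ s n := by
      change ν (Subtype.val ⁻¹' {z : Ω × ℝ | κ z.1 (A z.2) ≤ s n}) ≤ s n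
      rw [← Measure.map_apply measurable_subtype_coe hSm, hκ, Measure.compProd_apply hSm]
      calc _ ≤ ∫⁻ _, s n ∂m := lintegral_mono fun ω => hA' (κ ω) inferInstance (s n)
        _ = s n := by simp
    refine (hΦ.measure_eq_zero_or_one hν (measurable_subtype_coe hSm) fun t => ?_).resolve_right ?_
    · have h1 := disintegration_equivariant hf hm hKc hK hν hκ t hAx (hAm t)
      have h2 : ∀ᵐ p ∂ν, ∀ x, (p.1.1, x) ∈ K →
          κ (σ t p.1.1) (A (u σ f t p.1.1 x)) = κ p.1.1 (A x) := by
        have hq : ν.map (fun p : K => p.1.1) = m := by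
          rw [← Measure.fst_compProd m κ, ← hκ, Measure.fst,
            Measure.map_map measurable_fst measurable_subtype_coe]
          rfl
        rw [← hq] at h1
        exact ae_of_ae_map (measurable_fst.comp measurable_subtype_coe).aemeasurable h1
      filter_upwards [h2] with p hp
      have := hp p.1.2 p.2
      simp only [mem_preimage, mem_ofPred_eq, ← this]
      rfl
    · intro h
      exact absurd (h.symm.le.trans hle) (not_le.2 (hs1 n).2)
  have hall : ∀ᵐ p ∂ν, ∀ n, ¬ κ p.1.1 (A p.1.2) ≤ s n := ae_all_iff.2 fun n => by
    rw [ae_iff]; simpa using key n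
  filter_upwards [hall] with p hp
  exact le_antisymm prob_le_one (le_of_tendsto' hs fun n => (not_le.1 (hp n)).le)

end Disintegration

/-! ### Ergodic measures as graphs of equilibria. -/

section Representation

variable {Ω : Type*} [MetricSpace Ω] [CompactSpace Ω] [MeasurableSpace Ω] [BorelSpace Ω]
  {σ : Flow ℝ Ω} {f : Ω × ℝ → ℝ} {m : Measure Ω} {K : Set (Ω × ℝ)}
  (hf : IsC01 f) (hm : IsErgodicMeasure (fun t ω => σ t ω) m)
  (hKc : IsCompact K) (hK : IsTauInvariant σ f K) (hKΩ : Prod.fst '' K = univ)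

/-- The upper envelope of a subset of `Ω × ℝ`. -/
noncomputable def upperEnvelope (K : Set (Ω × ℝ)) (ω : Ω) : ℝ := sSup {x | (ω, x) ∈ K}

omit [CompactSpace Ω] [MeasurableSpace Ω] [BorelSpace Ω] in
include hKc hKΩ in
theorem isGreatest_upperEnvelope (ω : Ω) : IsGreatest {x | (ω, x) ∈ K} (upperEnvelope K ω) := by
  have hc : IsCompact {x | (ω, x) ∈ K} := by
    have h := (hKc.inter_right (isClosed_singleton.preimage continuous_fst : IsClosed
      (Prod.fst ⁻¹' {ω} : Set (Ω × ℝ)))).image continuous_snd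
    convert! h using 1
    ext x
    simp
  refine hc.isGreatest_sSup ?_
  obtain ⟨p, hp, rfl⟩ : ω ∈ Prod.fst '' K := hKΩ ▸ mem_univ ω
  exact ⟨p.2, hp⟩

include hKc hKΩ in
-- Superlevel sets are projections of compact sets, hence closed.
theorem measurable_upperEnvelope : Measurable (upperEnvelope K) := by
  refine measurable_of_Ici fun c => ?_
  have : upperEnvelope K ⁻¹' Ici c = Prod.fst '' (K ∩ Prod.snd ⁻¹' Ici c) := by
    ext ω
    have h := isGreatest_upperEnvelope hKc hKΩ ω
    constructor
    · intro hω
      exact ⟨(ω, upperEnvelope K ω), ⟨h.1, hω⟩, rfl⟩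
    · rintro ⟨p, ⟨hp, hc⟩, rfl⟩
      exact le_trans hc (h.2 hp)
  rw [this]
  exact ((hKc.inter_right (isClosed_Ici.preimage continuous_snd)).image
    continuous_fst).measurableSet

omit [MeasurableSpace Ω] [BorelSpace Ω] in
include hf hKc hKΩ hK in
-- Order-preserving bijections between fibres carry maximum to maximum.
theorem upperEnvelope_flow (ω : Ω) (t : ℝ) :
    upperEnvelope K (σ t ω) = u σ f t ω (upperEnvelope K ω) := by
  have h := isGreatest_upperEnvelope hKc hKΩ
  have hσ : σ (-t) (σ t ω) = ω := by rw [← σ.map_add, neg_add_cancel, σ.map_zero_apply]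
  refine le_antisymm ?_ ((h (σ t ω)).2 (hK _ (h ω).1 t).2)
  have h1 := (hK _ (h (σ t ω)).1 (-t)).2
  have h2 := hK.tau_neg_tau hf (h (σ t ω)).1 (-t)
  have h3 : tau σ f (-t) (σ t ω, upperEnvelope K (σ t ω)) =
      (ω, u σ f (-t) (σ t ω) (upperEnvelope K (σ t ω))) := Prod.ext hσ rfl
  rw [neg_neg, h3] at h2
  rw [h3] at h1
  have h4 := (hK.u_le_u_iff hf h1 (h ω).1 t).2 ((h ω).2 h1)
  rwa [show u σ f t ω _ = _ from congrArg Prod.snd h2] at h4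

include hf hKc hK hKΩ hm in
/-- Every ergodic measure over `m` is carried by the graph of a Borel measurable equilibrium. -/
theorem exists_equilibrium {ν : Measure K} (hν : ν ∈ ergodicMeasuresOver hK m) :
    ∃ β : Ω → ℝ, Measurable β ∧ IsEquilibrium σ f β ∧ ∃ hβ : ∀ ω, (ω, β ω) ∈ K,
      ν = m.map fun ω => (⟨(ω, β ω), hβ ω⟩ : K) := by
  obtain ⟨hν, hνm⟩ := hν
  have := hν.1
  have := hm.1
  have hΦ := isMeasurableFlow_tauOn hf hKc hK
  have : StandardBorelSpace K := hKc.measurableSet.standardBorel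
  have hπ : Measurable fun p : K => p.1.1 := measurable_fst.comp measurable_subtype_coe
  have hy : Measurable fun p : K => p.1.2 := measurable_snd.comp measurable_subtype_coe
  set ρ : Measure (Ω × ℝ) := ν.map Subtype.val with hρ
  have : IsProbabilityMeasure ρ := Measure.isProbabilityMeasure_map measurable_subtype_coe.aemeasurable
  have hfst : ρ.fst = m := by
    rw [Measure.fst, hρ, Measure.map_map measurable_fst measurable_subtype_coe, ← hνm]
    rfl
  set κ : Kernel Ω ℝ := ρ.condKernel with hκdef
  have hκ : ν.map Subtype.val = m ⊗ₘ κ := by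
    rw [← hfst, hκdef, ρ.disintegrate ρ.condKernel]
  have hIic : MeasurableSet {z : ℝ × ℝ | z.2 ∈ Iic z.1} :=
    measurableSet_le measurable_snd measurable_fst
  have hIci : MeasurableSet {z : ℝ × ℝ | z.2 ∈ Ici z.1} :=
    measurableSet_le measurable_fst measurable_snd
  have a₁ := ae_conditional_eq_one hf hm hKc hK hν hκ (A := Iic) hIic
    (fun t ω x y hx hy => hK.u_le_u_iff hf hy hx t)
    (fun μ _ s => measure_setOf_measure_Iic_le μ s)
  have a₂ := ae_conditional_eq_one hf hm hKc hK hν hκ (A := Ici) hIci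
    (fun t ω x y hx hy => hK.u_le_u_iff hf hx hy t)
    (fun μ _ s => measure_setOf_measure_Ici_le μ s)
  have hF : ∀ A : ℝ → Set ℝ, MeasurableSet {z : ℝ × ℝ | z.2 ∈ A z.1} →
      MeasurableSet {p : K | κ p.1.1 (A p.1.2) = 1} := fun A hA =>
    Kernel.measurable_kernel_prodMk_left (κ := κ.comap (fun p : K => p.1.1) hπ)
      (t := {z : K × ℝ | z.2 ∈ A z.1.1.2})
      ((hy.comp measurable_fst).prodMk measurable_snd hA) (measurableSet_singleton 1)
  -- The points carrying all of their fibre measure. Two of them in one fibre would give disjoint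
  -- half-lines of mass 1.
  set G : Set K := {p | κ p.1.1 (Iic p.1.2) = 1} ∩ {p | κ p.1.1 (Ici p.1.2) = 1}
  have hGm : MeasurableSet G := (hF _ hIic).inter (hF _ hIci)
  have hGlt : ∀ p ∈ G, ∀ q ∈ G, p.1.1 = q.1.1 → ¬ p.1.2 < q.1.2 := fun p hp q hq h hlt => by
    have hd : Disjoint (Iic p.1.2) (Ici q.1.2) :=
      Set.disjoint_left.2 fun x (h1 : x ≤ _) (h2 : _ ≤ x) => absurd (h2.trans h1) hlt.not_ge
    have h1 := measure_union (μ := κ p.1.1) hd measurableSet_Ici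
    rw [hp.1, h, hq.2] at h1
    have h2 : κ q.1.1 (Iic p.1.2 ∪ Ici q.1.2) ≤ 1 := prob_le_one
    rw [h1] at h2
    norm_num at h2
  have hGinj : ∀ p ∈ G, ∀ q ∈ G, p.1.1 = q.1.1 → p = q := fun p hp q hq h =>
    Subtype.ext (Prod.ext h (le_antisymm (not_lt.1 (hGlt q hq p hp h.symm))
      (not_lt.1 (hGlt p hp q hq h))))
  -- Passing to the orbit core gives strict invariance and keeps one point per fibre: two points
  -- over the same base point are in `G` at a common time, hence coincide.
  set C : Set K := orbitCore (tauOn hK) G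
  have hCm : MeasurableSet C := hΦ.measurableSet_orbitCore hGm
  have hCν : ∀ᵐ p ∂ν, p ∈ C :=
    hΦ.ae_mem_orbitCore hν hGm (by filter_upwards [a₁, a₂] with p h1 h2 using ⟨h1, h2⟩)
  have hCinj : InjOn (fun p : K => p.1.1) C := fun p hp q hq h => by
    obtain ⟨t, h1, h2⟩ := (Filter.Eventually.and (show ∀ᵐ t : ℝ, tauOn hK t p ∈ G from hp)
      (show ∀ᵐ t : ℝ, tauOn hK t q ∈ G from hq)).exists
    have := hGinj _ h1 _ h2 (congrArg (σ t) h)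
    rw [← hΦ.neg_apply t p, this, hΦ.neg_apply]
  -- Lusin–Souslin: injective measurable images of Borel sets are Borel.
  have himg : ∀ S ⊆ C, MeasurableSet S → MeasurableSet ((fun p : K => p.1.1) '' S) :=
    fun S hS hSm => hSm.image_of_measurable_injOn hπ (hCinj.mono hS)
  have htop := isGreatest_upperEnvelope hKc hKΩ
  classical
  -- Over fibres missing `C` the default is the upper envelope, itself an equilibrium, so the
  -- equilibrium equation holds at every `ω`.
  set b : Ω → K := fun ω => if h : ∃ p ∈ C, p.1.1 = ω then h.choose
    else ⟨(ω, upperEnvelope K ω), (htop ω).1⟩ with hb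
  have hb1 : ∀ ω, (b ω).1.1 = ω := fun ω => by
    simp only [hb]
    split_ifs with h
    · exact h.choose_spec.2
    · rfl
  have hbC : ∀ p ∈ C, b p.1.1 = p := fun p hp => by
    have h : ∃ q ∈ C, q.1.1 = p.1.1 := ⟨p, hp, rfl⟩
    simp only [hb, dif_pos h]
    exact hCinj h.choose_spec.1 hp h.choose_spec.2
  have hbD : ∀ ω, (¬ ∃ p ∈ C, p.1.1 = ω) → (b ω).1.2 = upperEnvelope K ω := fun ω h => by
    simp only [hb, dif_neg h]
  have hbK : ∀ ω, (ω, (b ω).1.2) ∈ K := fun ω => by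
    have := (b ω).2
    rwa [show (b ω).1 = (ω, (b ω).1.2) from Prod.ext (hb1 ω) rfl] at this
  have hbeq : ∀ ω, (⟨(ω, (b ω).1.2), hbK ω⟩ : K) = b ω := fun ω =>
    Subtype.ext (Prod.ext (hb1 ω).symm rfl)
  have hβm : Measurable fun ω => (b ω).1.2 := by
    intro S hS
    have : (fun ω => (b ω).1.2) ⁻¹' S = (fun p : K => p.1.1) '' (C ∩ (fun p : K => p.1.2) ⁻¹' S) ∪
        (((fun p : K => p.1.1) '' C)ᶜ ∩ upperEnvelope K ⁻¹' S) := by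
      ext ω
      by_cases h : ∃ p ∈ C, p.1.1 = ω
      · obtain ⟨p, hp, rfl⟩ := h
        simp only [mem_preimage, hbC p hp, mem_union, mem_image, mem_inter_iff, mem_compl_iff]
        constructor
        · exact fun h => Or.inl ⟨p, ⟨hp, h⟩, rfl⟩
        · rintro (⟨q, ⟨hq, hqS⟩, h⟩ | ⟨h, -⟩)
          · rwa [← hCinj hq hp h]
          · exact absurd ⟨p, hp, rfl⟩ h
      · have h' : ω ∉ (fun p : K => p.1.1) '' C := h
        simp only [mem_preimage, hbD ω h, mem_union, mem_inter_iff, mem_compl_iff]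
        constructor
        · exact fun hS => Or.inr ⟨h, hS⟩
        · rintro (⟨q, ⟨hq, -⟩, rfl⟩ | ⟨-, h⟩)
          · exact absurd ⟨q, hq, rfl⟩ h'
          · exact h
    rw [this]
    exact (himg _ inter_subset_left (hCm.inter (hy hS))).union
      ((himg _ Subset.rfl hCm).compl.inter (measurable_upperEnvelope hKc hKΩ hS))
  refine ⟨fun ω => (b ω).1.2, hβm, fun ω t => ⟨(hK _ (hbK ω) t).1, ?_⟩, hbK, ?_⟩
  · by_cases h : ∃ p ∈ C, p.1.1 = ω
    · obtain ⟨p, hp, rfl⟩ := h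
      have h2 : tauOn hK t p ∈ C := (hΦ.mem_orbitCore_iff t p).2 hp
      have h3 := hbC _ h2
      simp only [hbC p hp]
      exact congrArg (fun q : K => q.1.2) h3
    · have h' : ¬ ∃ p ∈ C, p.1.1 = σ t ω := fun ⟨p, hp, hpt⟩ => h
        ⟨tauOn hK (-t) p, (hΦ.mem_orbitCore_iff (-t) p).2 hp, by
          change σ (-t) p.1.1 = ω
          rw [hpt]
          exact (isMeasurableFlow_base σ).neg_apply t ω⟩
      simp only [hbD _ h, hbD _ h']
      exact upperEnvelope_flow hf hKc hK hKΩ ω t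
  · simp only [hbeq]
    have hbm : Measurable b := by
      rw [← funext hbeq]
      exact (measurable_id.prodMk hβm).subtype_mk
    change ν = m.map b
    rw [← hνm, Measure.map_map hbm hπ]
    conv_lhs => rw [← Measure.map_id (μ := ν)]
    refine Measure.map_congr ?_
    filter_upwards [hCν] with p hp
    exact (hbC p hp).symm

end Representation

/-- The first divided difference. -/
noncomputable def dividedDifference (F : ℝ → ℝ) (x y : ℝ) : ℝ := (F y - F x) / (y - x)

/-! ### Quadratic interpolation of a function with concave derivative. -/

section Concavity

/-- Concavity gives `k ≥ 0` between the ends, and a positive value anywhere would force `k b > 0`.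
This is the equality case behind both the weak and the strict inequalities below. -/
theorem _root_.ConcaveOn.eq_zero_on_Icc {k : ℝ → ℝ} (hk : ConcaveOn ℝ univ k) {a b c : ℝ}
    (hab : a < b) (hbc : b < c) (ha : 0 ≤ k a) (hb : k b ≤ 0) (hc : 0 ≤ k c) :
    ∀ y ∈ Icc a c, k y = 0 := by
  have comb : ∀ {x y z : ℝ}, x < y → y < z → (z - y) * k x + (y - x) * k z ≤ (z - x) * k y :=
    fun {x y z} hxy hyz => by
      have hz : 0 < z - x := by linarith
      have h := hk.2 (mem_univ x) (mem_univ z)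
        (div_nonneg (by linarith) hz.le : 0 ≤ (z - y) / (z - x))
        (div_nonneg (by linarith) hz.le : 0 ≤ (y - x) / (z - x)) (by field_simp; ring)
      have e : ((z - y) / (z - x)) • x + ((y - x) / (z - x)) • z = y := by
        simp only [smul_eq_mul]; field_simp; ring
      rw [e] at h
      simp only [smul_eq_mul] at h
      have h' := mul_le_mul_of_nonneg_left h hz.le
      calc _ = (z - x) * ((z - y) / (z - x) * k x + (y - x) / (z - x) * k z) := by
            field_simp
        _ ≤ _ := h'
  intro y hy
  apply le_antisymm
  · by_contra! hpos
    rcases lt_trichotomy y b with h | h | h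
    · have := comb h hbc
      nlinarith [mul_pos (sub_pos.2 hbc) hpos, mul_nonneg (sub_pos.2 h).le hc,
        mul_nonneg (sub_pos.2 (h.trans hbc)).le (neg_nonneg.2 hb)]
    · rw [h] at hpos; linarith
    · have := comb hab h
      nlinarith [mul_pos (sub_pos.2 hab) hpos, mul_nonneg (sub_pos.2 h).le ha,
        mul_nonneg (sub_pos.2 (hab.trans h)).le (neg_nonneg.2 hb)]
  · exact (le_min ha hc).trans (hk.min_le_of_mem_Icc (mem_univ _) (mem_univ _) hy)

variable {F h : ℝ → ℝ} {x₁ x₂ x₃ : ℝ}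

/-- The quadratic interpolation of `F` at three points, and Rolle's theorem for the remainder. -/
theorem exists_interpolation (hF : ∀ x, HasDerivAt F (h x) x) (h₁₂ : x₁ < x₂) (h₂₃ : x₂ < x₃) :
    ∃ (a b ξ₁ ξ₂ : ℝ) (g : ℝ → ℝ), (∀ x, HasDerivAt g (h x - (a + b * x)) x) ∧
      g x₁ = 0 ∧ g x₂ = 0 ∧ ξ₁ ∈ Ioo x₁ x₂ ∧ ξ₂ ∈ Ioo x₂ x₃ ∧
      h ξ₁ - (a + b * ξ₁) = 0 ∧ h ξ₂ - (a + b * ξ₂) = 0 ∧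
      a + b * x₁ = dividedDifference F x₁ x₂ + dividedDifference F x₁ x₃ -
        dividedDifference F x₂ x₃ ∧
      a + b * x₂ = dividedDifference F x₁ x₂ + dividedDifference F x₂ x₃ -
        dividedDifference F x₁ x₃ ∧
      a + b * x₃ = dividedDifference F x₁ x₃ + dividedDifference F x₂ x₃ -
        dividedDifference F x₁ x₂ := by
  have n₁ : x₂ - x₁ ≠ 0 := by linarith
  have n₂ : x₃ - x₂ ≠ 0 := by linarith
  have n₃ : x₃ - x₁ ≠ 0 := by linarith
  set s : ℝ := dividedDifference F x₁ x₂ with hs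
  set r : ℝ := dividedDifference F x₂ x₃ with hr
  set c : ℝ := (r - s) / (x₃ - x₁) with hc
  have es : F x₂ = F x₁ + s * (x₂ - x₁) := by rw [hs, dividedDifference]; field_simp; ring
  have er : F x₃ = F x₁ + s * (x₂ - x₁) + r * (x₃ - x₂) := by
    rw [← es, hr, dividedDifference]; field_simp; ring
  have e₁₃ : dividedDifference F x₁ x₃ = (s * (x₂ - x₁) + r * (x₃ - x₂)) / (x₃ - x₁) := by
    rw [dividedDifference, er]; ring
  -- Remainder of the Newton interpolation; `c` is the second divided difference.
  set g : ℝ → ℝ := fun x => F x - (F x₁ + s * (x - x₁) + c * ((x - x₁) * (x - x₂))) with hg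
  have hgd : ∀ x, HasDerivAt g (h x - (s - c * (x₁ + x₂) + 2 * c * x)) x := fun x => by
    have d₁ := (hasDerivAt_id x).sub_const x₁
    have d₂ := (hasDerivAt_id x).sub_const x₂
    have := (hF x).sub (((d₁.const_mul s).const_add (F x₁)).add ((d₁.mul d₂).const_mul c))
    convert! this using 1
    simp only [id]
    ring
  have g₁ : g x₁ = 0 := by simp [hg]
  have g₂ : g x₂ = 0 := by simp only [hg, es]; ring
  have g₃ : g x₃ = 0 := by simp only [hg, er, hc]; field_simp; ring
  have gc : Continuous g := continuous_iff_continuousAt.2 fun x => (hgd x).continuousAt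
  obtain ⟨ξ₁, m₁, z₁⟩ := exists_hasDerivAt_eq_zero h₁₂ gc.continuousOn (g₁.trans g₂.symm)
    fun x _ => hgd x
  obtain ⟨ξ₂, m₂, z₂⟩ := exists_hasDerivAt_eq_zero h₂₃ gc.continuousOn (g₂.trans g₃.symm)
    fun x _ => hgd x
  refine ⟨s - c * (x₁ + x₂), 2 * c, ξ₁, ξ₂, g, hgd, g₁, g₂, m₁, m₂, z₁, z₂, ?_, ?_, ?_⟩
  · rw [e₁₃, hc]; field_simp; ring
  · rw [e₁₃, hc]; field_simp; ring
  · rw [e₁₃, hc]; field_simp; ring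

theorem deriv_le_dividedDifferences (hF : ∀ x, HasDerivAt F (h x) x) (hh : ConcaveOn ℝ univ h)
    (h₁₂ : x₁ < x₂) (h₂₃ : x₂ < x₃) :
    h x₁ ≤ dividedDifference F x₁ x₂ + dividedDifference F x₁ x₃ - dividedDifference F x₂ x₃ ∧
    dividedDifference F x₁ x₂ + dividedDifference F x₂ x₃ - dividedDifference F x₁ x₃ ≤ h x₂ ∧
    h x₃ ≤ dividedDifference F x₁ x₃ + dividedDifference F x₂ x₃ - dividedDifference F x₁ x₂ := by
  obtain ⟨a, b, ξ₁, ξ₂, g, hg, g₁, g₂, m₁, m₂, z₁, z₂, l₁, l₂, l₃⟩ :=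
    exists_interpolation hF h₁₂ h₂₃
  have hk : ConcaveOn ℝ univ fun x => h x - (a + b * x) := by
    refine hh.sub ⟨convex_univ, fun x _ y _ s t _ _ hst => le_of_eq ?_⟩
    simp only [smul_eq_mul]
    linear_combination (-a) * hst
  rw [← l₁, ← l₂, ← l₃]
  have k₁ := fun H => hk.eq_zero_on_Icc m₁.1 (m₁.2.trans m₂.1) H z₁.le z₂.ge x₁
    ⟨le_rfl, by linarith [m₁.1, m₁.2, m₂.1]⟩
  have k₂ := fun H => hk.eq_zero_on_Icc m₁.2 m₂.1 z₁.ge H z₂.ge x₂ ⟨m₁.2.le, m₂.1.le⟩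
  have k₃ := fun H => hk.eq_zero_on_Icc (m₁.2.trans m₂.1) m₂.2 z₁.ge z₂.le H x₃
    ⟨by linarith [m₁.2, m₂.2, m₂.1], le_rfl⟩
  refine ⟨?_, ?_, ?_⟩
  · by_contra! H; linarith [k₁ (by linarith)]
  · by_contra! H; linarith [k₂ (by linarith)]
  · by_contra! H; linarith [k₃ (by linarith)]

/-- If a strict inequality failed, `h` would be affine on a whole gap between nodes. Each gap is
longer than `δ`, so it has room for a vanishing second difference, which `hd` forbids. -/
theorem deriv_lt_dividedDifferences (hF : ∀ x, HasDerivAt F (h x) x) (hh : ConcaveOn ℝ univ h)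
    {δ : ℝ} (hδ : 0 < δ) (h₁₂ : δ < x₂ - x₁) (h₂₃ : δ < x₃ - x₂)
    (hd : ∀ x, Icc (x - δ / 2) (x + δ / 2) ⊆ Icc x₁ x₃ →
      0 < 2 * h x - h (x - δ / 2) - h (x + δ / 2)) :
    h x₁ < dividedDifference F x₁ x₂ + dividedDifference F x₁ x₃ - dividedDifference F x₂ x₃ ∧
    dividedDifference F x₁ x₂ + dividedDifference F x₂ x₃ - dividedDifference F x₁ x₃ < h x₂ ∧
    h x₃ < dividedDifference F x₁ x₃ + dividedDifference F x₂ x₃ - dividedDifference F x₁ x₂ := by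
  obtain ⟨a, b, ξ₁, ξ₂, g, hg, g₁, g₂, m₁, m₂, z₁, z₂, l₁, l₂, l₃⟩ :=
    exists_interpolation hF (by linarith : x₁ < x₂) (by linarith : x₂ < x₃)
  have hk : ConcaveOn ℝ univ fun x => h x - (a + b * x) := by
    refine hh.sub ⟨convex_univ, fun x _ y _ s t _ _ hst => le_of_eq ?_⟩
    simp only [smul_eq_mul]
    linear_combination (-a) * hst
  have nonaffine : ∀ y z, x₁ ≤ y → z ≤ x₃ → δ < z - y →
      ¬ ∀ x ∈ Ioo y z, h x - (a + b * x) = 0 := fun y z hy hz hyz H => by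
    have := hd ((y + z) / 2) (Icc_subset_Icc (by linarith) (by linarith))
    linarith [H ((y + z) / 2) ⟨by linarith, by linarith⟩,
      H ((y + z) / 2 - δ / 2) ⟨by linarith, by linarith⟩,
      H ((y + z) / 2 + δ / 2) ⟨by linarith, by linarith⟩]
  rw [← l₁, ← l₂, ← l₃]
  refine ⟨?_, ?_, ?_⟩
  · by_contra! H
    have k₁ := hk.eq_zero_on_Icc m₁.1 (m₁.2.trans m₂.1) (by linarith) z₁.le z₂.ge
    exact nonaffine x₁ x₂ le_rfl (by linarith) h₁₂ fun x hx =>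
      k₁ x ⟨hx.1.le, by linarith [hx.2, m₂.1]⟩
  · by_contra! H
    have k₂ := hk.eq_zero_on_Icc m₁.2 m₂.1 z₁.ge (by linarith) z₂.ge
    -- Here equality gives vanishing only on `[ξ₁, ξ₂]`, which may be shorter than `δ`. But then `g`
    -- is antitone on `[x₁, x₂]` and zero at both ends, so it vanishes there and so does its
    -- derivative.
    have hneg : ∀ x ∈ interior (Icc x₁ x₂), deriv g x ≤ 0 := fun x hx => by
      rw [interior_Icc] at hx
      rw [(hg x).deriv]
      by_contra! hpos
      rcases le_or_gt ξ₁ x with h' | h'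
      · linarith [k₂ x ⟨h', by linarith [hx.2, m₂.1]⟩]
      · linarith [hk.eq_zero_on_Icc h' (m₁.2.trans m₂.1) hpos.le z₁.le z₂.ge x
          ⟨le_rfl, by linarith [m₁.2, m₂.1]⟩]
    have hanti : AntitoneOn g (Icc x₁ x₂) := antitoneOn_of_deriv_nonpos (convex_Icc _ _)
      (HasDerivAt.continuousOn fun x _ => hg x)
      (fun x _ => (hg x).differentiableAt.differentiableWithinAt) hneg
    refine nonaffine x₁ x₂ le_rfl (by linarith) h₁₂ fun x hx => ?_
    have : g =ᶠ[𝓝 x] fun _ => 0 := by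
      filter_upwards [Ioo_mem_nhds hx.1 hx.2] with y hy
      have hy' := Ioo_subset_Icc_self hy
      exact le_antisymm (g₁ ▸ hanti ⟨le_rfl, by linarith⟩ hy' hy'.1)
        (g₂ ▸ hanti hy' ⟨by linarith, le_rfl⟩ hy'.2)
    exact (hg x).unique ((hasDerivAt_const x (0 : ℝ)).congr_of_eventuallyEq this)
  · by_contra! H
    have k₃ := hk.eq_zero_on_Icc (m₁.2.trans m₂.1) m₂.2 z₁.ge z₂.le (by linarith)
    exact nonaffine x₂ x₃ (by linarith) le_rfl h₂₃ fun x hx =>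
      k₃ x ⟨by linarith [hx.1, m₁.2], hx.2.le⟩

end Concavity

theorem second_difference_nonneg {h : ℝ → ℝ} (hh : ConcaveOn ℝ univ h) (x δ : ℝ) :
    0 ≤ 2 * h x - h (x - δ / 2) - h (x + δ / 2) := by
  have := hh.2 (mem_univ (x - δ / 2)) (mem_univ (x + δ / 2))
    (by norm_num : (0 : ℝ) ≤ 1 / 2) (by norm_num : (0 : ℝ) ≤ 1 / 2) (by norm_num)
  simp only [smul_eq_mul] at this
  rw [show 1 / 2 * (x - δ / 2) + 1 / 2 * (x + δ / 2) = x by ring] at this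
  linarith

theorem second_difference_pos {Ω : Type*} {f : Ω × ℝ → ℝ} (hf : IsDC f) {J : Set ℝ} {δ : ℝ}
    (hδ : 0 < δ) {ω : Ω} (h : 0 < stdModule f J δ ω) {x : ℝ}
    (hx : Icc (x - δ / 2) (x + δ / 2) ⊆ J) :
    0 < 2 * fx f (ω, x) - fx f (ω, x - δ / 2) - fx f (ω, x + δ / 2) := by
  have hpos := pos_of_mul_pos_right h (by positivity)
  refine hpos.trans_le (csInf_le ⟨0, ?_⟩ ⟨x, hx, rfl⟩)
  rintro _ ⟨y, -, rfl⟩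
  exact second_difference_nonneg (hf ω) y δ

/-! ### Mean values along the flow and Lyapunov exponents. -/

section Integrals

variable {Ω : Type*} [MetricSpace Ω] [CompactSpace Ω] [MeasurableSpace Ω] [BorelSpace Ω]
  {σ : Flow ℝ Ω} {f : Ω × ℝ → ℝ} {m : Measure Ω} {K : Set (Ω × ℝ)}

theorem tendsto_one_div_succ_nhdsNE :
    Tendsto (fun n : ℕ => 1 / ((n : ℝ) + 1)) atTop (𝓝[≠] 0) :=
  tendsto_nhdsWithin_iff.2 ⟨tendsto_one_div_add_atTop_nhds_zero_nat,
    Eventually.of_forall fun n => by simp only [mem_compl_iff, mem_singleton_iff]; positivity⟩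

omit [CompactSpace Ω] in
/-- The orbital derivative of a bounded function has zero mean. -/
theorem integral_orbital_derivative_eq_zero [SecondCountableTopology Ω]
    (hm : IsErgodicMeasure (fun t ω => σ t ω) m)
    {G D : Ω → ℝ} (hG : Measurable G) {C L : ℝ} (hC : ∀ᵐ ω ∂m, |G ω| ≤ C)
    (hD : ∀ᵐ ω ∂m, ∀ t, HasDerivAt (fun s => G (σ s ω)) (D (σ t ω)) t ∧ |D (σ t ω)| ≤ L) :
    ∫ ω, D ω ∂m = 0 := by
  have := hm.1
  have hΦ : IsMeasurableFlow fun t ω => σ t ω :=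
    ⟨σ.map_zero_apply, σ.map_add, σ.cont'.measurable⟩
  have hGi : Integrable G m := Integrable.of_bound hG.aestronglyMeasurable C hC
  -- Difference quotients have zero mean by invariance and are bounded by `L` by the mean value
  -- inequality, so dominated convergence applies.
  set Q : ℕ → Ω → ℝ := fun n ω => (1 / ((n : ℝ) + 1))⁻¹ • (G (σ (1 / ((n : ℝ) + 1)) ω) - G ω)
    with hQ
  have hQi : ∀ n, ∫ ω, Q n ω ∂m = 0 := fun n => by
    have mp := hΦ.measurePreserving hm (1 / ((n : ℝ) + 1))
    have e : ∫ ω, G (σ (1 / ((n : ℝ) + 1)) ω) ∂m = ∫ ω, G ω ∂m := by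
      have := integral_map (μ := m) mp.measurable.aemeasurable (f := G) hG.aestronglyMeasurable
      rw [mp.map_eq] at this
      exact this.symm
    have hGt : Integrable (fun ω => G (σ (1 / ((n : ℝ) + 1)) ω)) m :=
      mp.integrable_comp_of_integrable hGi
    simp only [hQ]
    rw [integral_smul, integral_sub hGt hGi, e, sub_self,
      smul_zero]
  have lim : Tendsto (fun n => ∫ ω, Q n ω ∂m) atTop (𝓝 (∫ ω, D ω ∂m)) := by
    refine tendsto_integral_of_dominated_convergence (fun _ => L) (fun n => ?_)
      (integrable_const L) (fun n => ?_) ?_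
    · have hGt : Measurable fun ω => G (σ (1 / ((n : ℝ) + 1)) ω) :=
        hG.comp (hΦ.measurable_time _)
      have : Measurable (Q n) := (hGt.sub hG).const_smul (1 / ((n : ℝ) + 1))⁻¹
      exact this.aestronglyMeasurable
    · filter_upwards [hD] with ω hω
      have hmv := (convex_univ (𝕜 := ℝ)).norm_image_sub_le_of_norm_hasDerivWithin_le
        (f := fun s => G (σ s ω)) (f' := fun t => D (σ t ω)) (C := L)
        (fun t _ => (hω t).1.hasDerivWithinAt) (fun t _ => (hω t).2)
        (mem_univ 0) (mem_univ (1 / ((n : ℝ) + 1)))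
      simp only [σ.map_zero_apply, sub_zero] at hmv
      have hpos : 0 < 1 / ((n : ℝ) + 1) := by positivity
      simp only [hQ, norm_smul, norm_inv]
      rw [inv_mul_le_iff₀ (norm_pos_iff.2 hpos.ne'), mul_comm]
      exact hmv
    · filter_upwards [hD] with ω hω
      have h := ((hω 0).1.tendsto_slope_zero).comp tendsto_one_div_succ_nhdsNE
      simpa [hQ, Function.comp_def, σ.map_zero_apply] using h
  simp only [hQi] at lim
  exact (tendsto_nhds_unique lim tendsto_const_nhds)

variable (hf : IsC01 f) (hm : IsErgodicMeasure (fun t ω => σ t ω) m)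
  (hKc : IsCompact K) (hK : IsTauInvariant σ f K)

include hf in
theorem measurable_dividedDifference {α β : Ω → ℝ} (hα : Measurable α) (hβ : Measurable β) :
    Measurable fun ω => dividedDifference (fun x => f (ω, x)) (α ω) (β ω) :=
  ((hf.1.measurable.comp (measurable_id.prodMk hβ)).sub
    (hf.1.measurable.comp (measurable_id.prodMk hα))).div (hβ.sub hα)

omit [MeasurableSpace Ω] [BorelSpace Ω] in
include hf hKc in
theorem exists_lipschitz_bound : ∃ L : ℝ, 0 ≤ L ∧
    (∀ ω x y, (ω, x) ∈ K → (ω, y) ∈ K → |f (ω, y) - f (ω, x)| ≤ L * |y - x|) ∧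
    ∀ p ∈ K, |fx f p| ≤ L := by
  obtain ⟨R, hR⟩ := exists_abs_snd_le hKc
  obtain ⟨L, -, hL, hL'⟩ := hf.exists_lipschitzOnWith R
  exact ⟨L, L.2, fun ω x y hx hy => (hL ω).dist_le_mul y (hR _ hy) x (hR _ hx),
    fun p hp => hL' p.1 p.2 (hR p hp)⟩

omit [MetricSpace Ω] [CompactSpace Ω] [MeasurableSpace Ω] [BorelSpace Ω] in
theorem abs_dividedDifference_le {L : ℝ} (hL : 0 ≤ L)
    (h : ∀ ω x y, (ω, x) ∈ K → (ω, y) ∈ K → |f (ω, y) - f (ω, x)| ≤ L * |y - x|) {ω : Ω} {x y : ℝ}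
    (hx : (ω, x) ∈ K) (hy : (ω, y) ∈ K) :
    |dividedDifference (fun x => f (ω, x)) x y| ≤ L := by
  rw [dividedDifference, abs_div]
  exact div_le_of_le_mul₀ (abs_nonneg _) hL (h ω x y hx hy)

include hf hm hKc in
theorem integrable_dividedDifference {α β : Ω → ℝ} (hα : Measurable α) (hβ : Measurable β)
    (hαK : ∀ ω, (ω, α ω) ∈ K) (hβK : ∀ ω, (ω, β ω) ∈ K) :
    Integrable (fun ω => dividedDifference (fun x => f (ω, x)) (α ω) (β ω)) m := by
  have := hm.1
  obtain ⟨L, hL, h, -⟩ := exists_lipschitz_bound hf hKc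
  exact Integrable.of_bound (measurable_dividedDifference hf hα hβ).aestronglyMeasurable L
    (ae_of_all _ fun ω => abs_dividedDifference_le hL h (hαK ω) (hβK ω))

include hf hm hKc in
theorem integrable_fx_graph {α : Ω → ℝ} (hα : Measurable α) (hαK : ∀ ω, (ω, α ω) ∈ K) :
    Integrable (fun ω => fx f (ω, α ω)) m := by
  have := hm.1
  obtain ⟨L, -, -, h⟩ := exists_lipschitz_bound hf hKc
  exact Integrable.of_bound
    (hf.2.2.measurable.comp (measurable_id.prodMk hα)).aestronglyMeasurable L
    (ae_of_all _ fun ω => h _ (hαK ω))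

include hf hm hKc hK in
-- The integrand is the orbital derivative of `log (β - α)`, which may be unbounded because the gap
-- can approach 0. Hence `log (β - α + ε)` is used, whose orbital derivative is bounded by `L`
-- uniformly in `ε`, and then `ε` tends to 0.
theorem integral_dividedDifference_eq_zero {α β : Ω → ℝ} (hα : Measurable α) (hβ : Measurable β)
    (hαe : IsEquilibrium σ f α) (hβe : IsEquilibrium σ f β)
    (hαK : ∀ ω, (ω, α ω) ∈ K) (hβK : ∀ ω, (ω, β ω) ∈ K) (hlt : ∀ᵐ ω ∂m, α ω < β ω) :
    ∫ ω, dividedDifference (fun x => f (ω, x)) (α ω) (β ω) ∂m = 0 := by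
  have := hm.1
  obtain ⟨L, hL, hLip, -⟩ := exists_lipschitz_bound hf hKc
  obtain ⟨R, hR⟩ := exists_abs_snd_le hKc
  have hltt : ∀ ω, α ω < β ω → ∀ t, α (σ t ω) < β (σ t ω) := fun ω h t => by
    rw [(hαe ω t).2, (hβe ω t).2]
    exact hK.u_lt_u hf (hαK ω) (hβK ω) h t
  have hbd : ∀ ω, α ω < β ω → ∀ ε, 0 < ε →
      |(f (ω, β ω) - f (ω, α ω)) / (β ω - α ω + ε)| ≤ L := fun ω h ε hε => by
    rw [abs_div]
    refine div_le_of_le_mul₀ (abs_nonneg _) hL ((hLip ω _ _ (hαK ω) (hβK ω)).trans ?_)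
    gcongr
    linarith
  have hε : ∀ ε, 0 < ε → ∫ ω, (f (ω, β ω) - f (ω, α ω)) / (β ω - α ω + ε) ∂m = 0 := by
    intro ε hε
    refine integral_orbital_derivative_eq_zero hm (G := fun ω => Real.log (β ω - α ω + ε))
      (C := max |Real.log ε| |Real.log (2 * R + ε)|) (L := L)
      (Real.measurable_log.comp ((hβ.sub hα).add_const ε)) ?_ ?_
    · filter_upwards [hlt] with ω h
      have h1 := hR _ (hαK ω)
      have h2 := hR _ (hβK ω)
      exact abs_le_max_abs_abs (Real.log_le_log hε (by linarith))
        (Real.log_le_log (by linarith) (by linarith [h1.1, h2.2]))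
    · filter_upwards [hlt] with ω h t
      refine ⟨?_, hbd _ (hltt ω h t) ε hε⟩
      have hpos : 0 < β (σ t ω) - α (σ t ω) + ε := by linarith [hltt ω h t]
      have ea : (fun s => α (σ s ω)) = fun s => u σ f s ω (α ω) := funext fun s => (hαe ω s).2
      have eb : (fun s => β (σ s ω)) = fun s => u σ f s ω (β ω) := funext fun s => (hβe ω s).2
      have da : HasDerivAt (fun s => α (σ s ω)) (f (σ t ω, α (σ t ω))) t := by
        rw [ea, (hαe ω t).2]
        exact hK.hasDerivAt_u hf (hαK ω) t
      have db : HasDerivAt (fun s => β (σ s ω)) (f (σ t ω, β (σ t ω))) t := by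
        rw [eb, (hβe ω t).2]
        exact hK.hasDerivAt_u hf (hβK ω) t
      exact ((db.sub da).add_const ε).log hpos.ne'
  have lim : Tendsto (fun n : ℕ =>
      ∫ ω, (f (ω, β ω) - f (ω, α ω)) / (β ω - α ω + 1 / ((n : ℝ) + 1)) ∂m) atTop
      (𝓝 (∫ ω, dividedDifference (fun x => f (ω, x)) (α ω) (β ω) ∂m)) := by
    refine tendsto_integral_of_dominated_convergence (fun _ => L) (fun n => ?_)
      (integrable_const L) (fun n => ?_) ?_
    · exact (((hf.1.measurable.comp (measurable_id.prodMk hβ)).sub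
        (hf.1.measurable.comp (measurable_id.prodMk hα))).div
          ((hβ.sub hα).add_const _)).aestronglyMeasurable
    · filter_upwards [hlt] with ω h using hbd ω h _ (by positivity)
    · filter_upwards [hlt] with ω h
      have h1 : Tendsto (fun n : ℕ => β ω - α ω + 1 / ((n : ℝ) + 1)) atTop
          (𝓝 (β ω - α ω + 0)) := tendsto_one_div_add_atTop_nhds_zero_nat.const_add _
      rw [add_zero] at h1
      exact tendsto_const_nhds.div h1 (sub_pos.2 h).ne'
  simp only [hε _ Nat.one_div_pos_of_nat] at lim
  exact tendsto_nhds_unique lim tendsto_const_nhds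

omit [CompactSpace Ω] [BorelSpace Ω] in
include hm hKc in
/-- Strict d-concavity is visible, with positive probability, at the scale of the gaps. -/
theorem exists_scale (hSDC : IsSDCOn f m (variationInterval K)) {β₁ β₂ β₃ : Ω → ℝ}
    (h₁ : Measurable β₁) (h₂ : Measurable β₂) (h₃ : Measurable β₃)
    (k₁ : ∀ ω, (ω, β₁ ω) ∈ K) (k₃ : ∀ ω, (ω, β₃ ω) ∈ K)
    (h₁₂ : ∀ᵐ ω ∂m, β₁ ω < β₂ ω) (h₂₃ : ∀ᵐ ω ∂m, β₂ ω < β₃ ω) :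
    ∃ δ : ℝ, 0 < δ ∧ ∃ᵐ ω ∂m, (δ < β₂ ω - β₁ ω ∧ δ < β₃ ω - β₂ ω) ∧
      0 < stdModule f (variationInterval K) δ ω := by
  have := hm.1
  obtain ⟨-, ρ, hρ, hb⟩ := hSDC
  set gap : Ω → ℝ := fun ω => min (β₂ ω - β₁ ω) (β₃ ω - β₂ ω) with hgap
  have hgm : Measurable gap := (h₂.sub h₁).min (h₃.sub h₂)
  set A : ℕ → Set Ω := fun n => {ω | gap ω ≤ 1 / ((n : ℝ) + 1)} with hA
  have hAm : ∀ n, MeasurableSet (A n) := fun n => hgm measurableSet_Iic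
  have hanti : Antitone A := fun i j hij ω (hω : gap ω ≤ _) =>
    hω.trans (one_div_le_one_div_of_le (by positivity) (by gcongr))
  have hnull : m (⋂ n, A n) = 0 := by
    have : ∀ᵐ ω ∂m, ω ∉ ⋂ n, A n := by
      filter_upwards [h₁₂, h₂₃] with ω i j hmem
      have hle : gap ω ≤ 0 := ge_of_tendsto' tendsto_one_div_add_atTop_nhds_zero_nat
        fun n => mem_iInter.1 hmem n
      exact hle.not_gt (lt_min (sub_pos.2 i) (sub_pos.2 j))
    exact measure_eq_zero_iff_ae_notMem.2 this
  have lim := tendsto_measure_iInter_atTop (μ := m) (fun n => (hAm n).nullMeasurableSet) hanti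
    ⟨0, measure_ne_top _ _⟩
  rw [hnull] at lim
  -- Small gaps must have measure below `ρ`, to leave part of the set where the module is positive,
  -- and below 1, so that some fibre has large gaps. Two such gaps fit into the variation interval,
  -- whence `δ ≤ l(J) / 2`.
  have hpos : (0 : ENNReal) < min (ENNReal.ofReal ρ) 1 :=
    lt_min (ENNReal.ofReal_pos.2 hρ) one_pos
  obtain ⟨n, hn⟩ := (lim.eventually_lt_const hpos).exists
  have hδ : 0 < 1 / ((n : ℝ) + 1) := by positivity
  refine ⟨1 / ((n : ℝ) + 1), hδ, fun hcon => ?_⟩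
  obtain ⟨ω, hω⟩ : ∃ ω, ω ∉ A n := by
    by_contra! hall
    have : m (A n) = 1 := by rw [eq_univ_of_forall hall, measure_univ]
    exact (hn.trans_le (min_le_right _ _)).ne this
  have hω' : 1 / ((n : ℝ) + 1) < gap ω := not_le.1 hω
  have hc : IsCompact (Prod.snd '' K) := hKc.image continuous_snd
  have i₁ : sInf (Prod.snd '' K) ≤ β₁ ω := csInf_le hc.bddBelow ⟨_, k₁ ω, rfl⟩
  have i₃ : β₃ ω ≤ sSup (Prod.snd '' K) := le_csSup hc.bddAbove ⟨_, k₃ ω, rfl⟩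
  obtain ⟨j₁, j₂⟩ := lt_min_iff.1 hω'
  have hlen : 1 / ((n : ℝ) + 1) ≤ len (variationInterval K) / 2 := by
    rw [len, variationInterval, csSup_Icc (by linarith), csInf_Icc (by linarith)]
    linarith
  refine (hb _ hδ hlen).not_ge (le_trans (measure_mono_ae ?_) (hn.le.trans (min_le_left _ _)))
  filter_upwards [hcon] with ω' h' hpos'
  by_contra hlt
  exact h' ⟨lt_min_iff.1 (not_le.1 hlt), hpos'⟩

theorem integral_lt_integral_of_frequently_lt {X : Type*} [MeasurableSpace X] {μ : Measure X}
    {F G : X → ℝ} (hF : Integrable F μ) (hG : Integrable G μ) (hle : ∀ᵐ x ∂μ, F x ≤ G x)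
    (hlt : ∃ᵐ x ∂μ, F x < G x) : ∫ x, F x ∂μ < ∫ x, G x ∂μ := by
  refine lt_of_le_of_ne (integral_mono_ae hF hG hle) fun h => hlt ?_
  filter_upwards [(integral_eq_iff_of_ae_le hF hG hle).1 h] with x hx using hx.not_lt

include hf hm hKc hK in
/-- The signs of the Lyapunov exponents of three ordered equilibria. -/
theorem lyapunov_signs (hSDC : IsSDCOn f m (variationInterval K)) {β₁ β₂ β₃ : Ω → ℝ}
    (h₁ : Measurable β₁) (h₂ : Measurable β₂) (h₃ : Measurable β₃)
    (e₁ : IsEquilibrium σ f β₁) (e₂ : IsEquilibrium σ f β₂) (e₃ : IsEquilibrium σ f β₃)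
    (k₁ : ∀ ω, (ω, β₁ ω) ∈ K) (k₂ : ∀ ω, (ω, β₂ ω) ∈ K) (k₃ : ∀ ω, (ω, β₃ ω) ∈ K)
    (h₁₂ : ∀ᵐ ω ∂m, β₁ ω < β₂ ω) (h₂₃ : ∀ᵐ ω ∂m, β₂ ω < β₃ ω) :
    ∫ ω, fx f (ω, β₁ ω) ∂m < 0 ∧ 0 < ∫ ω, fx f (ω, β₂ ω) ∂m ∧
      ∫ ω, fx f (ω, β₃ ω) ∂m < 0 := by
  have h₁₃ : ∀ᵐ ω ∂m, β₁ ω < β₃ ω := by filter_upwards [h₁₂, h₂₃] with ω i j using i.trans j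
  have z₁₂ := integral_dividedDifference_eq_zero hf hm hKc hK h₁ h₂ e₁ e₂ k₁ k₂ h₁₂
  have z₁₃ := integral_dividedDifference_eq_zero hf hm hKc hK h₁ h₃ e₁ e₃ k₁ k₃ h₁₃
  have z₂₃ := integral_dividedDifference_eq_zero hf hm hKc hK h₂ h₃ e₂ e₃ k₂ k₃ h₂₃
  have i₁₂ := integrable_dividedDifference hf hm hKc h₁ h₂ k₁ k₂
  have i₁₃ := integrable_dividedDifference hf hm hKc h₁ h₃ k₁ k₃
  have i₂₃ := integrable_dividedDifference hf hm hKc h₂ h₃ k₂ k₃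
  have hF : ∀ ω x, HasDerivAt (fun y => f (ω, y)) (fx f (ω, x)) x := fun ω x =>
    (hf.2.1 ω x).hasDerivAt
  have hle := fun ω i j => deriv_le_dividedDifferences (hF ω) (hSDC.1 ω)
    (x₁ := β₁ ω) (x₂ := β₂ ω) (x₃ := β₃ ω) i j
  obtain ⟨δ, hδ, hfreq⟩ := exists_scale hm hKc hSDC h₁ h₂ h₃ k₁ k₃ h₁₂ h₂₃
  have hc : IsCompact (Prod.snd '' K) := hKc.image continuous_snd
  have hlt := hfreq.mono fun ω hω => deriv_lt_dividedDifferences (hF ω) (hSDC.1 ω) hδ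
    hω.1.1 hω.1.2 fun x hx => second_difference_pos hSDC.1 hδ hω.2 (hx.trans
      (Icc_subset_Icc (csInf_le hc.bddBelow ⟨_, k₁ ω, rfl⟩) (le_csSup hc.bddAbove ⟨_, k₃ ω, rfl⟩)))
  -- Each exponent is compared with the mean of the interpolant's derivative at that node, which is
  -- zero.
  refine ⟨?_, ?_, ?_⟩
  · have := integral_lt_integral_of_frequently_lt (integrable_fx_graph hf hm hKc h₁ k₁)
      ((i₁₂.add i₁₃).sub i₂₃) (by filter_upwards [h₁₂, h₂₃] with ω i j using (hle ω i j).1)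
      (hlt.mono fun ω h => h.1)
    rwa [integral_sub' (i₁₂.add i₁₃) i₂₃, integral_add' i₁₂ i₁₃, z₁₂, z₁₃, z₂₃, add_zero,
      sub_zero] at this
  · have := integral_lt_integral_of_frequently_lt ((i₁₂.add i₂₃).sub i₁₃)
      (integrable_fx_graph hf hm hKc h₂ k₂)
      (by filter_upwards [h₁₂, h₂₃] with ω i j using (hle ω i j).2.1)
      (hlt.mono fun ω h => h.2.1)
    rwa [integral_sub' (i₁₂.add i₂₃) i₁₃, integral_add' i₁₂ i₂₃, z₁₂, z₁₃, z₂₃, add_zero,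
      sub_zero] at this
  · have := integral_lt_integral_of_frequently_lt (integrable_fx_graph hf hm hKc h₃ k₃)
      ((i₁₃.add i₂₃).sub i₁₂) (by filter_upwards [h₁₂, h₂₃] with ω i j using (hle ω i j).2.2)
      (hlt.mono fun ω h => h.2.2)
    rwa [integral_sub' (i₁₃.add i₂₃) i₁₂, integral_add' i₁₃ i₂₃, z₁₂, z₁₃, z₂₃, add_zero,
      sub_zero] at this

end Integrals

/-- Serves to list ergodic measures in increasing order of the mean of the fibre coordinate. -/
theorem exists_strictMono_family {α : Type*} {E : Set α} {I : α → ℝ} (hI : InjOn I E) {n : ℕ}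
    (hn : (n : ℕ∞) ≤ E.encard) : ∃ e : Fin n → α, (∀ i, e i ∈ E) ∧ StrictMono fun i => I (e i) := by
  obtain ⟨T, hTE, hT⟩ := exists_subset_encard_eq hn
  have hTI : (I '' T).encard = n := by rw [(hI.mono hTE).encard_image, hT]
  have hfin : (I '' T).Finite := finite_of_encard_eq_coe hTI
  have hcard : hfin.toFinset.card = n := by
    rw [hfin.encard_eq_coe_toFinset_card] at hTI
    exact_mod_cast hTI
  have hmem : ∀ i, hfin.toFinset.orderEmbOfFin hcard i ∈ I '' T := fun i =>
    hfin.mem_toFinset.1 (Finset.orderEmbOfFin_mem _ hcard i)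
  choose e heT heI using hmem
  refine ⟨e, fun i => hTE (heT i), ?_⟩
  simp only [heI]
  exact (hfin.toFinset.orderEmbOfFin hcard).strictMono

/-! ### Ordering equilibria and ergodic measures. -/

section Order

variable {Ω : Type*} [MetricSpace Ω] [CompactSpace Ω] [MeasurableSpace Ω] [BorelSpace Ω]
  {σ : Flow ℝ Ω} {f : Ω × ℝ → ℝ} {m : Measure Ω} {K : Set (Ω × ℝ)}
  (hf : IsC01 f) (hm : IsErgodicMeasure (fun t ω => σ t ω) m)
  (hKc : IsCompact K) (hK : IsTauInvariant σ f K)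

include hf hm hK in
-- Monotone fibre maps make the set strictly invariant under `σ`, so ergodicity of `m` applies
-- directly.
theorem measure_lt_eq_zero_or_one {α β : Ω → ℝ} (hα : Measurable α) (hβ : Measurable β)
    (hαe : IsEquilibrium σ f α) (hβe : IsEquilibrium σ f β)
    (hαK : ∀ ω, (ω, α ω) ∈ K) (hβK : ∀ ω, (ω, β ω) ∈ K) :
    m {ω | α ω < β ω} = 0 ∨ m {ω | α ω < β ω} = 1 := by
  refine hm.2.2 _ (measurableSet_lt hα hβ) fun t => ?_
  rw [(isMeasurableFlow_base σ).image_eq]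
  ext ω
  change α (σ (-t) ω) < β (σ (-t) ω) ↔ α ω < β ω
  rw [(hαe ω _).2, (hβe ω _).2, ← not_le, ← not_le, hK.u_le_u_iff hf (hβK ω) (hαK ω)]

include hf hm hK in
theorem ae_trichotomy {α β : Ω → ℝ} (hα : Measurable α) (hβ : Measurable β)
    (hαe : IsEquilibrium σ f α) (hβe : IsEquilibrium σ f β)
    (hαK : ∀ ω, (ω, α ω) ∈ K) (hβK : ∀ ω, (ω, β ω) ∈ K) :
    (∀ᵐ ω ∂m, α ω < β ω) ∨ (∀ᵐ ω ∂m, β ω < α ω) ∨ ∀ᵐ ω ∂m, α ω = β ω := by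
  have := hm.1
  have full : ∀ {α β : Ω → ℝ}, Measurable α → Measurable β → m {ω | α ω < β ω} = 1 →
      ∀ᵐ ω ∂m, α ω < β ω := fun hα hβ h => (prob_compl_eq_zero_iff (measurableSet_lt hα hβ)).2 h
  rcases measure_lt_eq_zero_or_one hf hm hK hα hβ hαe hβe hαK hβK with h | h
  · rcases measure_lt_eq_zero_or_one hf hm hK hβ hα hβe hαe hβK hαK with h' | h'
    · right; right
      filter_upwards [measure_eq_zero_iff_ae_notMem.1 h, measure_eq_zero_iff_ae_notMem.1 h']
        with ω i j using le_antisymm (not_lt.1 j) (not_lt.1 i)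
    · exact Or.inr (Or.inl (full hβ hα h'))
  · exact Or.inl (full hα hβ h)

theorem integral_graph_measure {β : Ω → ℝ} (hβ : Measurable β) (hβK : ∀ ω, (ω, β ω) ∈ K)
    {g : Ω × ℝ → ℝ} (hg : Continuous g) :
    ∫ p : K, g p.1 ∂(m.map fun ω => (⟨(ω, β ω), hβK ω⟩ : K)) = ∫ ω, g (ω, β ω) ∂m := by
  have hb : Measurable fun ω => (⟨(ω, β ω), hβK ω⟩ : K) := (measurable_id.prodMk hβ).subtype_mk
  exact integral_map hb.aemeasurable
    (hg.measurable.comp measurable_subtype_coe).aestronglyMeasurable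

/-- A Borel measurable equilibrium in `K` carrying `ν`. -/
structure IsCarrier (σ : Flow ℝ Ω) (f : Ω × ℝ → ℝ) (m : Measure Ω) (ν : Measure K)
    (β : Ω → ℝ) : Prop where
  measurable : Measurable β
  equilibrium : IsEquilibrium σ f β
  mem : ∀ ω, (ω, β ω) ∈ K
  eq_map : ν = m.map fun ω => (⟨(ω, β ω), mem ω⟩ : K)

namespace IsCarrier

variable {ν ν' : Measure K} {α β : Ω → ℝ}

theorem integral_eq (h : IsCarrier σ f m ν β) {g : Ω × ℝ → ℝ} (hg : Continuous g) :
    ∫ p : K, g p.1 ∂ν = ∫ ω, g (ω, β ω) ∂m := by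
  conv_lhs => rw [h.eq_map]
  exact integral_graph_measure h.measurable h.mem hg

theorem represents (h : IsCarrier σ f m ν β) : Represents σ f m β ν :=
  ⟨h.equilibrium, h.measurable.nullMeasurable, h.mem, fun _ hg => h.integral_eq hg⟩

omit [CompactSpace Ω] [BorelSpace Ω] in
include hm hKc in
theorem integrable (h : IsCarrier σ f m ν β) : Integrable β m := by
  have := hm.1
  obtain ⟨R, hR⟩ := exists_abs_snd_le hKc
  exact Integrable.of_bound h.measurable.aestronglyMeasurable R
    (ae_of_all _ fun ω => abs_le.2 (hR _ (h.mem ω)))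

include hf hm hKc hK in
-- The mean of the fibre coordinate excludes the reversed order in the trichotomy, and carriers
-- equal almost everywhere carry the same measure.
theorem eq_or_ae_lt (h : IsCarrier σ f m ν α) (h' : IsCarrier σ f m ν' β)
    (hle : ∫ p : K, p.1.2 ∂ν ≤ ∫ p : K, p.1.2 ∂ν') : ν = ν' ∨ ∀ᵐ ω ∂m, α ω < β ω := by
  have := hm.1
  rcases ae_trichotomy hf hm hK h.measurable h'.measurable h.equilibrium h'.equilibrium h.mem h'.mem
    with hlt | hlt | heq
  · exact Or.inr hlt
  · have key := integral_lt_integral_of_frequently_lt (h'.integrable hm hKc) (h.integrable hm hKc)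
      (hlt.mono fun ω => le_of_lt) hlt.frequently
    rw [h.integral_eq continuous_snd, h'.integral_eq continuous_snd] at hle
    exact absurd hle key.not_ge
  · left
    rw [h.eq_map, h'.eq_map]
    exact Measure.map_congr (heq.mono fun ω e => Subtype.ext (Prod.ext rfl e))

end IsCarrier

end Order

end SkewFlow

theorem theorem4p1 {Ω : Type*} [MetricSpace Ω] [CompactSpace Ω] [MeasurableSpace Ω] [BorelSpace Ω]
    (σ : Flow ℝ Ω) (f : Ω × ℝ → ℝ) (hf : SkewFlow.IsC01 f)
    (m : Measure Ω) (hm : SkewFlow.IsErgodicMeasure (fun t ω => σ t ω) m)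
    (K : Set (Ω × ℝ)) (hKc : IsCompact K) (hK : SkewFlow.IsTauInvariant σ f K)
    (hKΩ : Prod.fst '' K = univ)
    (hSDC : SkewFlow.IsSDCOn f m (SkewFlow.variationInterval K)) :
    (SkewFlow.ergodicMeasuresOver hK m).encard ≤ 3 ∧
    ((SkewFlow.ergodicMeasuresOver hK m).encard = 3 →
      ∃ (ν₁ ν₂ ν₃ : Measure K) (β₁ β₂ β₃ : Ω → ℝ),
        SkewFlow.ergodicMeasuresOver hK m = {ν₁, ν₂, ν₃} ∧
        SkewFlow.Represents σ f m β₁ ν₁ ∧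
        SkewFlow.Represents σ f m β₂ ν₂ ∧
        SkewFlow.Represents σ f m β₃ ν₃ ∧
        (∀ᵐ ω ∂m, β₁ ω < β₂ ω ∧ β₂ ω < β₃ ω) ∧
        SkewFlow.lyapunov f ν₁ < 0 ∧
        0 < SkewFlow.lyapunov f ν₂ ∧
        SkewFlow.lyapunov f ν₃ < 0) := by
  set E := SkewFlow.ergodicMeasuresOver hK m
  have hcar : ∀ ν ∈ E, ∃ β, SkewFlow.IsCarrier σ f m ν β := fun ν hν => by
    obtain ⟨β, h₁, h₂, h₃, h₄⟩ := SkewFlow.exists_equilibrium hf hm hKc hK hKΩ hν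
    exact ⟨β, h₁, h₂, h₃, h₄⟩
  choose! B hB using hcar
  have hInj : InjOn (fun ν : Measure K => ∫ p : K, p.1.2 ∂ν) E := fun ν hν ν' hν' h => by
    have := hm.1
    rcases (hB ν hν).eq_or_ae_lt hf hm hKc hK (hB ν' hν') h.le with h₁ | h₁
    · exact h₁
    · rcases (hB ν' hν').eq_or_ae_lt hf hm hKc hK (hB ν hν) h.ge with h₂ | h₂
      · exact h₂.symm
      · obtain ⟨ω, i, j⟩ := (h₁.and h₂).exists
        exact absurd i j.not_gt
  have hlt : ∀ ν ∈ E, ∀ ν' ∈ E, ∫ p : K, p.1.2 ∂ν < ∫ p : K, p.1.2 ∂ν' →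
      ∀ᵐ ω ∂m, B ν ω < B ν' ω := fun ν hν ν' hν' h =>
    ((hB ν hν).eq_or_ae_lt hf hm hKc hK (hB ν' hν') h.le).resolve_left fun e => by
      rw [e] at h; exact lt_irrefl _ h
  have hsign : ∀ ν₁ ∈ E, ∀ ν₂ ∈ E, ∀ ν₃ ∈ E, (∀ᵐ ω ∂m, B ν₁ ω < B ν₂ ω) →
      (∀ᵐ ω ∂m, B ν₂ ω < B ν₃ ω) → SkewFlow.lyapunov f ν₁ < 0 ∧ 0 < SkewFlow.lyapunov f ν₂ ∧
        SkewFlow.lyapunov f ν₃ < 0 := fun ν₁ h₁ ν₂ h₂ ν₃ h₃ h₁₂ h₂₃ => by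
    simp only [SkewFlow.lyapunov, (hB ν₁ h₁).integral_eq hf.2.2, (hB ν₂ h₂).integral_eq hf.2.2,
      (hB ν₃ h₃).integral_eq hf.2.2]
    exact SkewFlow.lyapunov_signs hf hm hKc hK hSDC (hB ν₁ h₁).measurable (hB ν₂ h₂).measurable
      (hB ν₃ h₃).measurable (hB ν₁ h₁).equilibrium (hB ν₂ h₂).equilibrium (hB ν₃ h₃).equilibrium
      (hB ν₁ h₁).mem (hB ν₂ h₂).mem (hB ν₃ h₃).mem h₁₂ h₂₃
  constructor
  · by_contra! hcon
    have h4 : ((4 : ℕ) : ℕ∞) ≤ E.encard := by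
      have := Order.add_one_le_of_lt hcon
      norm_num at this ⊢
      exact this
    obtain ⟨e, heE, hmono⟩ := SkewFlow.exists_strictMono_family hInj h4
    have l : ∀ i j, i < j → ∀ᵐ ω ∂m, B (e i) ω < B (e j) ω := fun i j hij =>
      hlt _ (heE i) _ (heE j) (hmono hij)
    have s₁ := hsign _ (heE 0) _ (heE 1) _ (heE 2) (l 0 1 (by decide)) (l 1 2 (by decide))
    have s₂ := hsign _ (heE 1) _ (heE 2) _ (heE 3) (l 1 2 (by decide)) (l 2 3 (by decide))
    -- The measure `e 1` is the middle of the first triple and the bottom of the second.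
    exact lt_asymm s₁.2.1 s₂.1
  · intro h3
    obtain ⟨e, heE, hmono⟩ := SkewFlow.exists_strictMono_family hInj (n := 3) (by rw [h3]; norm_num)
    have l : ∀ i j, i < j → ∀ᵐ ω ∂m, B (e i) ω < B (e j) ω := fun i j hij =>
      hlt _ (heE i) _ (heE j) (hmono hij)
    have l₁ := l 0 1 (by decide)
    have l₂ := l 1 2 (by decide)
    have hinj : Function.Injective e := fun i j hij => hmono.injective (by simp only [hij])
    have hrange : range e = {e 0, e 1, e 2} := by
      ext ν
      simp [Fin.exists_fin_succ, eq_comm]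
    -- Three distinct members exhaust a set of cardinality three.
    have hE : range e = E := by
      refine Set.Finite.eq_of_subset_of_encard_le (finite_range e)
        (range_subset_iff.2 heE) ?_
      rw [h3, ← image_univ, hinj.encard_image, encard_univ]
      simp
    exact ⟨e 0, e 1, e 2, B (e 0), B (e 1), B (e 2), by rw [← hE, hrange],
      (hB _ (heE 0)).represents, (hB _ (heE 1)).represents, (hB _ (heE 2)).represents,
      l₁.and l₂, hsign _ (heE 0) _ (heE 1) _ (heE 2) l₁ l₂⟩
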